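/- Let $\mathbb S^2\subset\mathbb R^3$ be the standard unit sphere and let $(r,\theta)$, $0<r<\pi$, $\theta\in\mathbb R/2\pi\mathbb Z$, be geodesic polar coordinates about the north pole, $(r,\theta)\mapsto(\sin r\cos\theta,\sin r\sin\theta,\cos r)$. Let $\Omega\subset\mathbb S^2$ be a rotationally symmetric domain, i.e. a nonempty connected open set invariant under all rotations about the axis through the poles. Let $\varepsilon\in\{+1,-1\}$ and let $q>0$, $q\neq1$, be real. Consider in $\Omega$ the equation $$\Delta_{\mathbb S^2}u=\varepsilon\,u|u|^{q-1}.\qquad(*)$$ A solution is a real function that is of class $C^2$ and satisfies the equation at all points of $\Omega$ other than the poles (so a solution may be singular at a pole belonging to $\Omega$). On these points, a solution is called radial if it depends only on $r$, and pseudo-radial if $u(r,\theta)=h(r)w(\theta)$ for a function $h$ and a $2\pi$-periodic function $w$. (i) If $\varepsilon=+1$ or $q\neq3$, then every pseudo-radial solution of $(*)$ in $\Omega$ is radial. (ii) For every integer $k\ge2$ there is a $C^2$ solution $w_k:\mathbb R\to\mathbb R$ of the ODE $$w''+w=-w^3$$ with least positive period $\frac{2\pi}{k}$ and $w_k(0)=0$;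 it is unique up to sign among the solutions with these properties, and every solution of the ODE with least period $\frac{2\pi}{k}$ is a translate $\theta\mapsto w_k(\theta+c)$, $c\in\mathbb R$. The equation $\Delta_{\mathbb S^2}u=-u^3$ admits infinitely many non-radial pseudo-radial solutions in $\Omega$ (as functions on $\Omega$ without the poles), and these are exactly the functions of the form $$u(r,\theta)=\frac{w_k(\theta+c)}{\sin r},\qquad k\ge2,\ c\in\mathbb R.$$ -/

import Mathlib

noncomputable section

/-- Euclidean three-space. -/
abbrev E3 : Type := EuclideanSpace ℝ (Fin 3)

/-- The standard unit sphere `S²`. -/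
abbrev S2 : Type := Metric.sphere (0 : E3) 1

theorem normalize_mem_S2 {x : E3} (hx : x ≠ 0) : ‖x‖⁻¹ • x ∈ Metric.sphere (0 : E3) 1 := by
  have h : ‖x‖ ≠ 0 := norm_ne_zero_iff.mpr hx
  simp [norm_smul, h]

/-- The extension of `u : S² → ℝ` to `ℝ³ ∖ {0}` which is constant along rays,
`x ↦ u (x / ‖x‖)` (with the irrelevant value `0` at the origin). -/
def radialExtension (u : S2 → ℝ) (x : E3) : ℝ :=
  open Classical in if hx : x = 0 then 0 else u ⟨‖x‖⁻¹ • x, normalize_mem_S2 hx⟩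

/-- The Laplace–Beltrami operator of the round sphere: the restriction to `S²` of the Euclidean
Laplacian of the extension of `u` that is constant along rays. -/
def sphereLaplacian (u : S2 → ℝ) (x : S2) : ℝ :=
  Laplacian.laplacian (radialExtension u) (x : E3)

theorem polarPoint_mem (r θ : ℝ) :
    (!₂[Real.sin r * Real.cos θ, Real.sin r * Real.sin θ, Real.cos r] : E3) ∈
      Metric.sphere (0 : E3) 1 := by
  rw [mem_sphere_zero_iff_norm, EuclideanSpace.norm_eq, Real.sqrt_eq_one, Fin.sum_univ_three]
  simp only [Real.norm_eq_abs, sq_abs]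
  simp
  nlinarith [Real.sin_sq_add_cos_sq r, Real.sin_sq_add_cos_sq θ]

/-- The point of `S²` with geodesic polar coordinates `(r, θ)` about the north pole. -/
def polarPoint (r θ : ℝ) : S2 :=
  ⟨!₂[Real.sin r * Real.cos θ, Real.sin r * Real.sin θ, Real.cos r], polarPoint_mem r θ⟩

theorem axialRotation_mem (α : ℝ) (x : S2) :
    (!₂[Real.cos α * x.1 0 - Real.sin α * x.1 1, Real.sin α * x.1 0 + Real.cos α * x.1 1,
      x.1 2] : E3) ∈ Metric.sphere (0 : E3) 1 := by
  have hx := x.2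
  rw [mem_sphere_zero_iff_norm, EuclideanSpace.norm_eq, Real.sqrt_eq_one,
    Fin.sum_univ_three] at hx ⊢
  simp only [Real.norm_eq_abs, sq_abs] at hx ⊢
  simp
  linear_combination hx + ((x.1 0) ^ 2 + (x.1 1) ^ 2) * Real.sin_sq_add_cos_sq α

/-- Rotation of `S²` by the angle `α` about the vertical axis. -/
def axialRotation (α : ℝ) (x : S2) : S2 :=
  ⟨!₂[Real.cos α * x.1 0 - Real.sin α * x.1 1, Real.sin α * x.1 0 + Real.cos α * x.1 1, x.1 2],
    axialRotation_mem α x⟩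

/-- A domain (nonempty connected open set) of `S²` invariant under all rotations about the
vertical axis: a geodesic disc or annulus centred at a pole, the whole sphere, and so on. -/
structure IsRotSymmDomain (Ω : Set S2) : Prop where
  isOpen : IsOpen Ω
  isConnected : IsConnected Ω
  rotation_mem : ∀ (α : ℝ), ∀ x ∈ Ω, axialRotation α x ∈ Ω

/-- The points of `Ω` other than the two poles, i.e. the part of `Ω` covered by the polar
coordinates `(r, θ)` with `0 < r < π`. -/
def awayFromPoles (Ω : Set S2) : Set S2 :=
  {x | ∃ r ∈ Set.Ioo 0 Real.pi, ∃ θ : ℝ, x = polarPoint r θ ∧ x ∈ Ω}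

/-- `u` is a classical solution of `Δ_{S²} u = f(u)` in `Ω`, possibly singular at the poles:
it is `C²` and satisfies the equation at every point of `Ω` other than the poles. -/
def IsSphereSolution (Ω : Set S2) (f : ℝ → ℝ) (u : S2 → ℝ) : Prop :=
  ∀ x ∈ awayFromPoles Ω,
    ContDiffAt ℝ 2 (radialExtension u) (x : E3) ∧ sphereLaplacian u x = f (u x)

/-- `u(r, θ) = h(r)` in polar coordinates on `Ω`. -/
def IsRadial (Ω : Set S2) (u : S2 → ℝ) : Prop :=
  ∃ h : ℝ → ℝ, ∀ r ∈ Set.Ioo 0 Real.pi, ∀ θ : ℝ,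
    polarPoint r θ ∈ Ω → u (polarPoint r θ) = h r

/-- `u(r, θ) = h(r) w(θ)` in polar coordinates on `Ω`, with `w` a `2π`-periodic function. -/
def IsPseudoRadial (Ω : Set S2) (u : S2 → ℝ) : Prop :=
  ∃ h w : ℝ → ℝ, Function.Periodic w (2 * Real.pi) ∧
    ∀ r ∈ Set.Ioo 0 Real.pi, ∀ θ : ℝ,
      polarPoint r θ ∈ Ω → u (polarPoint r θ) = h r * w θ

/-- `w` is a (global, `C²`) solution of the ODE `w'' + w = -w³`. -/
def SolvesODE (w : ℝ → ℝ) : Prop :=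
  ContDiff ℝ 2 w ∧ ∀ θ : ℝ, iteratedDeriv 2 w θ + w θ = -(w θ) ^ 3

/-- `T` is the least positive period of `w`. -/
def HasLeastPeriod (w : ℝ → ℝ) (T : ℝ) : Prop :=
  IsLeast {t : ℝ | 0 < t ∧ Function.Periodic w t} T

/-- The set of non-radial pseudo-radial solutions of `Δ_{S²} u = -u³` in `Ω`. -/
def nonradialPseudoRadialSolutions (Ω : Set S2) : Set (S2 → ℝ) :=
  {u | IsSphereSolution Ω (fun t => -t ^ 3) u ∧ IsPseudoRadial Ω u ∧ ¬ IsRadial Ω u}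

end

open Real Filter Topology MeasureTheory intervalIntegral

/-! ### Uniqueness for second order linear equations -/

/-! Insert `u = h(r) w(θ)` into the polar form of the Laplacian. Wherever `h(r) ≠ 0` this reads `w''
= -A(r) w + ε κ(r) w|w|^(q-1)`, with `κ = |h|^(q-1) sin² r` and `A = (h'' + cot r · h') sin² r / h`.
If `w` is continuous and nonconstant, `w` and `w|w|^(q-1)` are linearly independent, so `κ` and `A`
are constant. Constancy of `κ` gives `h = K (sin r)^p` with `p = -2/(q-1)`, and constancy of `A`
then forces `p = -1`. Hence `q = 3`, `A = 1`, and `W = K w` is a nonconstant `2π`-periodic solution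
of `W'' + W = ε W³` (`separation_of_variables`, `nonradial_form`).

For `ε = 1` there is no such `W` (`defocusing_eq`). A solution without zeros is constant because a
suitable quantity is both monotone and periodic. For a nontrivial solution with zeros, Sturm
comparison with the sine puts successive zeros more than `π` apart, while a period of length `2π`
would contain two such gaps.

For `ε = -1` the energy `w'² + w² + w⁴/2 = s²` is conserved. Writing `w' = s cos φ` and `w √(1 +
w²/2) = s sin φ` turns the equation into a first-order equation for the phase `φ`. The least period
is therefore the integral over `[0, 2π]` of `phaseSlowness (s sin x)`. It decreases strictly and
continuously from `2π` at `s = 0` to `0` at infinity, so each `2π/k` with `k ≥ 2` belongs to exactly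
one slope `s > 0`, and these are the only least periods of which `2π` is a multiple. Every solution
is a translate of the orbit starting at `0` with slope `s`, which gives the classification; the
converse is a direct computation. -/

theorem eq_zero_of_second_order_linear {d p c : ℝ → ℝ} {C a : ℝ}
    (hd : ∀ t, HasDerivAt d (p t) t) (hp : ∀ t, HasDerivAt p (c t * d t) t)
    (hc : ∀ t, |c t| ≤ C) (hda : d a = 0) (hpa : p a = 0) : ∀ t, d t = 0 := by
  let v : ℝ → ℝ × ℝ → ℝ × ℝ := fun t z => (z.2, c t * z.1)
  have hv : ∀ t, LipschitzOnWith (Real.toNNReal (max 1 C)) (v t) Set.univ := by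
    intro t
    refine LipschitzWith.lipschitzOnWith (LipschitzWith.of_dist_le_mul fun x y => ?_)
    rw [Real.coe_toNNReal _ (le_max_of_le_left zero_le_one), Prod.dist_eq, Prod.dist_eq]
    simp only [v, Real.dist_eq]
    have h1 : |x.1 - y.1| ≤ max |x.1 - y.1| |x.2 - y.2| := le_max_left _ _
    have h2 : |x.2 - y.2| ≤ max |x.1 - y.1| |x.2 - y.2| := le_max_right _ _
    have h0 := (abs_nonneg _).trans h1
    refine max_le ?_ ?_
    · calc |x.2 - y.2| ≤ 1 * max |x.1 - y.1| |x.2 - y.2| := by linarith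
        _ ≤ _ := by gcongr; exact le_max_left _ _
    · rw [← mul_sub, abs_mul]
      have := (hc t).trans (le_max_right 1 C)
      gcongr
  have key : (fun t => (d t, p t)) = fun _ => ((0 : ℝ), (0 : ℝ)) := by
    refine ODE_solution_unique_univ (v := v) (s := fun _ => Set.univ) (t₀ := a) hv
      (fun t => ⟨(hd t).prodMk (hp t), trivial⟩) (fun t => ⟨?_, trivial⟩) (by simp [hda, hpa])
    refine (hasDerivAt_const t ((0 : ℝ), (0 : ℝ))).congr_deriv ?_
    simp only [v, mul_zero]
    rfl
  intro t
  exact congrArg Prod.fst (congrFun key t)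

/-! ### The ODE as a first-order system, its energy and uniqueness -/

theorem contDiff_two_of_hasDerivAt {v p q : ℝ → ℝ} (hv : ∀ t, HasDerivAt v (p t) t)
    (hp : ∀ t, HasDerivAt p (q t) t) (hq : Continuous q) : ContDiff ℝ 2 v := by
  have e1 : deriv v = p := funext fun t => (hv t).deriv
  have e2 : deriv p = q := funext fun t => (hp t).deriv
  have h1 : ContDiff ℝ 1 p :=
    contDiff_one_iff_deriv.2 ⟨fun t => (hp t).differentiableAt, by rwa [e2]⟩
  have : ContDiff ℝ (1 + 1) v :=
    contDiff_succ_iff_deriv.2 ⟨fun t => (hv t).differentiableAt, by simp, by rwa [e1]⟩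
  simpa [one_add_one_eq_two] using this

theorem ContDiff.hasDerivAt_iteratedDeriv_two {v : ℝ → ℝ} (hv : ContDiff ℝ 2 v) (t : ℝ) :
    HasDerivAt v (deriv v t) t ∧ HasDerivAt (deriv v) (iteratedDeriv 2 v t) t := by
  have h : ContDiff ℝ (1 + 1) v := by simpa [one_add_one_eq_two] using hv
  have h1 := (contDiff_succ_iff_deriv.1 h).2.2
  refine ⟨(hv.differentiable (by norm_num) t).hasDerivAt, ?_⟩
  rw [iteratedDeriv_succ, iteratedDeriv_one]
  exact (h1.differentiable (by norm_num) t).hasDerivAt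

theorem iteratedDeriv_two_of_hasDerivAt {v p q : ℝ → ℝ} (hv : ∀ t, HasDerivAt v (p t) t)
    (hp : ∀ t, HasDerivAt p (q t) t) (t : ℝ) : iteratedDeriv 2 v t = q t := by
  have e1 : deriv v = p := funext fun t => (hv t).deriv
  rw [iteratedDeriv_succ, iteratedDeriv_one, e1, (hp t).deriv]

theorem solvesODE_iff {v : ℝ → ℝ} : SolvesODE v ↔
    ∃ p : ℝ → ℝ, (∀ t, HasDerivAt v (p t) t) ∧ ∀ t, HasDerivAt p (-v t - v t ^ 3) t := by
  constructor
  · rintro ⟨hv, h⟩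
    refine ⟨deriv v, fun t => (hv.hasDerivAt_iteratedDeriv_two t).1, fun t => ?_⟩
    have := (hv.hasDerivAt_iteratedDeriv_two t).2
    rwa [show iteratedDeriv 2 v t = -v t - v t ^ 3 by linarith [h t]] at this
  · rintro ⟨p, h1, h2⟩
    have hc : Continuous v := continuous_iff_continuousAt.2 fun t => (h1 t).continuousAt
    refine ⟨contDiff_two_of_hasDerivAt h1 h2 (by fun_prop), fun t => ?_⟩
    rw [iteratedDeriv_two_of_hasDerivAt h1 h2 t]
    ring

theorem energy_eq {v p : ℝ → ℝ} (hv : ∀ t, HasDerivAt v (p t) t)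
    (hp : ∀ t, HasDerivAt p (-v t - v t ^ 3) t) (t s : ℝ) :
    p t ^ 2 + v t ^ 2 + v t ^ 4 / 2 = p s ^ 2 + v s ^ 2 + v s ^ 4 / 2 := by
  have h : ∀ t, HasDerivAt (fun t => p t ^ 2 + v t ^ 2 + v t ^ 4 / 2) 0 t := by
    intro t
    have := (((hp t).pow 2).add ((hv t).pow 2)).add (((hv t).pow 4).div_const 2)
    refine this.congr_deriv ?_
    push_cast
    ring
  exact is_const_of_deriv_eq_zero (fun t => (h t).differentiableAt) (fun t => (h t).deriv) t s

/-- The difference `d = v - w` satisfies `d'' = -(1 + v² + vw + w²) d`, and conservation of energy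
bounds the coefficient. So the linear uniqueness statement applies although the cubic is not
globally Lipschitz. -/
theorem eq_of_initial_data {v p w r : ℝ → ℝ} (hv : ∀ t, HasDerivAt v (p t) t)
    (hp : ∀ t, HasDerivAt p (-v t - v t ^ 3) t) (hw : ∀ t, HasDerivAt w (r t) t)
    (hr : ∀ t, HasDerivAt r (-w t - w t ^ 3) t) (h0 : v 0 = w 0) (h1 : p 0 = r 0) : v = w := by
  have bv : ∀ t, v t ^ 2 ≤ p 0 ^ 2 + v 0 ^ 2 + v 0 ^ 4 / 2 := fun t => by
    have := energy_eq hv hp t 0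
    nlinarith [sq_nonneg (p t), sq_nonneg (v t ^ 2)]
  have bw : ∀ t, w t ^ 2 ≤ r 0 ^ 2 + w 0 ^ 2 + w 0 ^ 4 / 2 := fun t => by
    have := energy_eq hw hr t 0
    nlinarith [sq_nonneg (r t), sq_nonneg (w t ^ 2)]
  have key := eq_zero_of_second_order_linear (d := fun t => v t - w t) (p := fun t => p t - r t)
    (c := fun t => -(1 + v t ^ 2 + v t * w t + w t ^ 2)) (a := 0)
    (C := 1 + 2 * (p 0 ^ 2 + v 0 ^ 2 + v 0 ^ 4 / 2) + 2 * (r 0 ^ 2 + w 0 ^ 2 + w 0 ^ 4 / 2))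
    (fun t => (hv t).sub (hw t))
    (fun t => by
      have := (hp t).sub (hr t)
      refine this.congr_deriv ?_
      ring)
    (fun t => by
      rw [abs_neg, abs_le]
      constructor <;> nlinarith [bv t, bw t, sq_nonneg (v t + w t), sq_nonneg (v t - w t)])
    (by simp [h0]) (by simp [h1])
  funext t
  linarith [key t]

/-! ### Amplitude-phase coordinates

With `y = w √(1 + w² / 2)`, so that `y² = w² + w⁴ / 2`, the equation `w'' + w = -w³` becomes
`y = s sin φ`, `w' = s cos φ`, `φ' = 1 / phaseSlowness (s sin φ)`. -/

/-- `1 + w²` as a function of `y = w √(1 + w² / 2)`. -/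
noncomputable def ampR (y : ℝ) : ℝ := √(1 + 2 * y ^ 2)

/-- `√(1 + w² / 2)` as a function of `y = w √(1 + w² / 2)`. -/
noncomputable def ampS (y : ℝ) : ℝ := √((1 + ampR y) / 2)

/-- The derivative of `amplitude`. -/
noncomputable def phaseSlowness (y : ℝ) : ℝ := ampS y / ampR y

/-- The inverse function of `w ↦ w √(1 + w² / 2)`. -/
noncomputable def amplitude (y : ℝ) : ℝ := y / ampS y

theorem ampR_sq (y : ℝ) : ampR y ^ 2 = 1 + 2 * y ^ 2 := Real.sq_sqrt (by positivity)

theorem one_le_ampR (y : ℝ) : 1 ≤ ampR y := by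
  rw [ampR, Real.one_le_sqrt]
  nlinarith [sq_nonneg y]

theorem ampS_sq (y : ℝ) : ampS y ^ 2 = (1 + ampR y) / 2 :=
  Real.sq_sqrt (by linarith [one_le_ampR y])

theorem ampS_pos (y : ℝ) : 0 < ampS y := Real.sqrt_pos.2 (by linarith [one_le_ampR y])

theorem ampR_pos (y : ℝ) : 0 < ampR y := zero_lt_one.trans_le (one_le_ampR y)

theorem phaseSlowness_pos (y : ℝ) : 0 < phaseSlowness y := div_pos (ampS_pos y) (ampR_pos y)

theorem continuous_ampR : Continuous ampR := by unfold ampR; fun_prop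

theorem continuous_ampS : Continuous ampS := by
  have := continuous_ampR
  unfold ampS
  fun_prop

theorem continuous_phaseSlowness : Continuous phaseSlowness :=
  continuous_ampS.div continuous_ampR fun y => (ampR_pos y).ne'

theorem hasDerivAt_amplitude (y : ℝ) : HasDerivAt amplitude (phaseSlowness y) y := by
  have hR := ampR_pos y
  have hS := ampS_pos y
  have h1 : HasDerivAt ampR (2 * y / ampR y) y := by
    have h : HasDerivAt (fun y : ℝ => 1 + 2 * y ^ 2) (4 * y) y := by
      have := ((hasDerivAt_pow 2 y).const_mul 2).const_add 1
      refine this.congr_deriv ?_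
      norm_num
      ring
    have := h.sqrt (by positivity)
    refine this.congr_deriv ?_
    change 4 * y / (2 * ampR y) = _
    field_simp
    ring
  have h2 : HasDerivAt ampS (y / (2 * ampR y * ampS y)) y := by
    have := ((h1.const_add 1).div_const 2).sqrt (by linarith)
    refine this.congr_deriv ?_
    change _ / (2 * ampS y) = _
    field_simp
  have := (hasDerivAt_id y).div h2 hS.ne'
  refine this.congr_deriv ?_
  have e1 := ampR_sq y
  have e2 := ampS_sq y
  simp only [id, phaseSlowness]
  field_simp
  have e3 : ampR y = 2 * ampS y ^ 2 - 1 := by linarith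
  have e4 : 2 * y ^ 2 = ampR y ^ 2 - 1 := by linarith
  have e5 : ampS y ^ 4 = ((1 + ampR y) / 2) ^ 2 := by rw [← e2]; ring
  nlinarith

theorem ampR_lt_ampR {x y : ℝ} (h : x ^ 2 < y ^ 2) : ampR x < ampR y :=
  Real.sqrt_lt_sqrt (by positivity) (by linarith)

theorem phaseSlowness_sq (y : ℝ) : phaseSlowness y ^ 2 = (1 + ampR y) / (2 * ampR y ^ 2) := by
  rw [phaseSlowness, div_pow, ampS_sq]
  field_simp

/-- The square of `phaseSlowness` is `(1 + R) / (2R²)` with `R = ampR`, which decreases in `R`. This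
is the source of the strict monotonicity of the period. -/
theorem phaseSlowness_lt {x y : ℝ} (h : x ^ 2 < y ^ 2) : phaseSlowness y < phaseSlowness x := by
  refine lt_of_pow_lt_pow_left₀ 2 (phaseSlowness_pos x).le ?_
  have hR := ampR_lt_ampR h
  have h1 := one_le_ampR x
  have h2 := one_le_ampR y
  rw [phaseSlowness_sq, phaseSlowness_sq, div_lt_div_iff₀ (by positivity) (by positivity)]
  nlinarith [mul_pos (ampR_pos x) (ampR_pos y), mul_pos (sub_pos.2 hR) (ampR_pos x),
    mul_pos (sub_pos.2 hR) (mul_pos (ampR_pos x) (ampR_pos y)),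
    mul_pos (sub_pos.2 hR) (ampR_pos y)]

theorem phaseSlowness_zero : phaseSlowness 0 = 1 := by
  have hR : ampR 0 = 1 := by simp [ampR]
  have hS : ampS 0 = 1 := by simp [ampS, hR]
  simp [phaseSlowness, hR, hS]

theorem phaseSlowness_le_one (y : ℝ) : phaseSlowness y ≤ 1 := by
  rcases eq_or_ne y 0 with rfl | hy
  · exact phaseSlowness_zero.le
  · rw [← phaseSlowness_zero]
    exact (phaseSlowness_lt (by rw [zero_pow two_ne_zero]; positivity)).le

theorem phaseSlowness_sq_le (y : ℝ) : phaseSlowness y ^ 2 ≤ (ampR y)⁻¹ := by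
  have := one_le_ampR y
  rw [phaseSlowness_sq, inv_eq_one_div, div_le_div_iff₀ (by positivity) (by positivity)]
  nlinarith

theorem amplitude_mul_sqrt (v : ℝ) : amplitude (v * √(1 + v ^ 2 / 2)) = v := by
  have hpos : 0 < 1 + v ^ 2 / 2 := by positivity
  have hR : ampR (v * √(1 + v ^ 2 / 2)) = 1 + v ^ 2 := by
    rw [ampR, mul_pow, Real.sq_sqrt hpos.le]
    rw [show 1 + 2 * (v ^ 2 * (1 + v ^ 2 / 2)) = (1 + v ^ 2) ^ 2 by ring]
    exact Real.sqrt_sq (by positivity)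
  have hS : ampS (v * √(1 + v ^ 2 / 2)) = √(1 + v ^ 2 / 2) := by
    rw [ampS, hR]
    congr 1
    ring
  rw [amplitude, hS]
  exact mul_div_cancel_right₀ _ (Real.sqrt_pos.2 hpos).ne'

/-- This is half the derivative of `y² = w² + w⁴/2` with `w = amplitude y`. It is the identity that
turns the phase equation back into `w'' = -w - w³`. -/
theorem amplitude_add_cube (y : ℝ) :
    (amplitude y + amplitude y ^ 3) * phaseSlowness y = y := by
  have hR := ampR_pos y
  have hS := ampS_pos y
  have e1 := ampR_sq y
  have e2 := ampS_sq y
  rw [amplitude, phaseSlowness]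
  field_simp
  have e3 : y ^ 2 = (ampR y - 1) * ampS y ^ 2 := by rw [e2]; linarith
  rw [e3]
  ring

theorem amplitude_eq_zero_iff {y : ℝ} : amplitude y = 0 ↔ y = 0 := by
  simp [amplitude, (ampS_pos y).ne']

/-! ### The time map -/

/-- The time at which the orbit of initial slope `s` starting at `0` reaches the phase `φ`. -/
noncomputable def orbitTime (s φ : ℝ) : ℝ := ∫ x in (0 : ℝ)..φ, phaseSlowness (s * sin x)

theorem continuous_phaseSlowness_mul_sin (s : ℝ) :
    Continuous fun x => phaseSlowness (s * sin x) :=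
  continuous_phaseSlowness.comp (by fun_prop)

theorem hasDerivAt_orbitTime (s φ : ℝ) :
    HasDerivAt (orbitTime s) (phaseSlowness (s * sin φ)) φ :=
  ((continuous_phaseSlowness_mul_sin s).integral_hasStrictDerivAt 0 φ).hasDerivAt

theorem periodic_phaseSlowness (s : ℝ) :
    Function.Periodic (fun x => phaseSlowness (s * sin x)) (2 * π) := fun x => by
  simp only [Real.sin_add_two_pi]

theorem strictMono_orbitTime (s : ℝ) : StrictMono (orbitTime s) :=
  strictMono_of_deriv_pos fun φ => by
    rw [(hasDerivAt_orbitTime s φ).deriv]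
    exact phaseSlowness_pos _

theorem continuous_orbitTime (s : ℝ) : Continuous (orbitTime s) :=
  continuous_iff_continuousAt.2 fun φ => (hasDerivAt_orbitTime s φ).continuousAt

theorem surjective_orbitTime (s : ℝ) : Function.Surjective (orbitTime s) :=
  (continuous_orbitTime s).surjective
    ((periodic_phaseSlowness s).tendsto_atTop_intervalIntegral_of_pos'
      ((continuous_phaseSlowness_mul_sin s).intervalIntegrable _ _)
      (fun _ => phaseSlowness_pos _) two_pi_pos)
    ((periodic_phaseSlowness s).tendsto_atBot_intervalIntegral_of_pos'
      ((continuous_phaseSlowness_mul_sin s).intervalIntegrable _ _)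
      (fun _ => phaseSlowness_pos _) two_pi_pos)

theorem orbitTime_zero (s : ℝ) : orbitTime s 0 = 0 := by simp [orbitTime]

theorem orbitTime_add_two_pi (s φ : ℝ) :
    orbitTime s (φ + 2 * π) = orbitTime s φ + orbitTime s (2 * π) := by
  have := (periodic_phaseSlowness s).intervalIntegral_add_eq_add 0 φ
    fun _ _ => (continuous_phaseSlowness_mul_sin s).intervalIntegrable _ _
  rw [zero_add] at this
  exact this

theorem orbitTime_zsmul (s : ℝ) (n : ℤ) :
    orbitTime s (n * (2 * π)) = n * orbitTime s (2 * π) := by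
  have := (periodic_phaseSlowness s).intervalIntegral_add_zsmul_eq n 0
    fun _ _ => (continuous_phaseSlowness_mul_sin s).intervalIntegrable _ _
  simpa [orbitTime] using this

/-- The phase of the orbit of initial slope `s`, as a function of time. -/
noncomputable def phase (s t : ℝ) : ℝ :=
  ((strictMono_orbitTime s).orderIsoOfSurjective _ (surjective_orbitTime s)).symm t

theorem orbitTime_phase (s t : ℝ) : orbitTime s (phase s t) = t :=
  ((strictMono_orbitTime s).orderIsoOfSurjective _ (surjective_orbitTime s)).apply_symm_apply t

theorem phase_orbitTime (s φ : ℝ) : phase s (orbitTime s φ) = φ :=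
  (strictMono_orbitTime s).injective (orbitTime_phase s _)

theorem continuous_phase (s : ℝ) : Continuous (phase s) :=
  ((strictMono_orbitTime s).orderIsoOfSurjective _ (surjective_orbitTime s)).symm.continuous

theorem hasDerivAt_phase (s t : ℝ) :
    HasDerivAt (phase s) (phaseSlowness (s * sin (phase s t)))⁻¹ t :=
  (hasDerivAt_orbitTime s (phase s t)).of_local_left_inverse (continuous_phase s).continuousAt
    (phaseSlowness_pos _).ne' (Eventually.of_forall fun y => orbitTime_phase s y)

theorem phase_zero (s : ℝ) : phase s 0 = 0 := by
  simpa [orbitTime_zero] using phase_orbitTime s 0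

/-- The solution of `w'' + w = -w³` with `w(0) = 0`, `w'(0) = s`. -/
noncomputable def orbit (s t : ℝ) : ℝ := amplitude (s * sin (phase s t))

theorem hasDerivAt_orbit (s t : ℝ) : HasDerivAt (orbit s) (s * cos (phase s t)) t := by
  have h1 := ((hasDerivAt_phase s t).sin).const_mul s
  have := (hasDerivAt_amplitude (s * sin (phase s t))).comp t h1
  refine this.congr_deriv ?_
  have := (phaseSlowness_pos (s * sin (phase s t))).ne'
  field_simp

theorem hasDerivAt_orbit_slope (s t : ℝ) :
    HasDerivAt (fun t => s * cos (phase s t)) (-orbit s t - orbit s t ^ 3) t := by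
  have h1 := ((hasDerivAt_phase s t).cos).const_mul s
  refine h1.congr_deriv ?_
  have h := (phaseSlowness_pos (s * sin (phase s t))).ne'
  have e := amplitude_add_cube (s * sin (phase s t))
  unfold orbit
  field_simp
  linear_combination e

theorem orbit_zero (s : ℝ) : orbit s 0 = 0 := by simp [orbit, phase_zero, amplitude]

theorem solvesODE_orbit_add (s c : ℝ) : SolvesODE fun t => orbit s (t + c) :=
  solvesODE_iff.2 ⟨fun t => s * cos (phase s (t + c)),
    fun t => (hasDerivAt_orbit s (t + c)).comp_add_const t c,
    fun t => (hasDerivAt_orbit_slope s (t + c)).comp_add_const t c⟩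

/-- Every solution is a translate of some `orbit s`. -/
theorem SolvesODE.exists_eq_orbit {v : ℝ → ℝ} (hv : SolvesODE v) :
    ∃ s : ℝ, 0 ≤ s ∧ ∃ c : ℝ, v = fun t => orbit s (t + c) := by
  obtain ⟨p, h1, h2⟩ := solvesODE_iff.1 hv
  -- The modulus of `z` is the slope `s` and its argument is the initial phase, as `(w', y) = (s cos
  -- φ, s sin φ)`.
  let z : ℂ := ⟨p 0, v 0 * √(1 + v 0 ^ 2 / 2)⟩
  refine ⟨‖z‖, norm_nonneg _, orbitTime ‖z‖ z.arg, ?_⟩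
  refine eq_of_initial_data h1 h2
    (fun t => (hasDerivAt_orbit ‖z‖ (t + orbitTime ‖z‖ z.arg)).comp_add_const t _)
    (fun t => (hasDerivAt_orbit_slope ‖z‖ (t + orbitTime ‖z‖ z.arg)).comp_add_const t _) ?_ ?_
  · rw [zero_add, orbit, phase_orbitTime, Complex.norm_mul_sin_arg]
    exact (amplitude_mul_sqrt _).symm
  · rw [zero_add, phase_orbitTime, Complex.norm_mul_cos_arg]

theorem orbit_zero_left (t : ℝ) : orbit 0 t = 0 := by simp [orbit, amplitude]

theorem phase_add_period (s t : ℝ) : phase s (t + orbitTime s (2 * π)) = phase s t + 2 * π := by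
  apply (strictMono_orbitTime s).injective
  rw [orbitTime_phase, orbitTime_add_two_pi, orbitTime_phase]

theorem periodic_orbit (s : ℝ) : Function.Periodic (orbit s) (orbitTime s (2 * π)) := fun t => by
  rw [orbit, orbit, phase_add_period, Real.sin_add_two_pi]

/-- The periods of `orbit s` are the integer multiples of `orbitTime s (2 * π)`. -/
theorem eq_mul_of_periodic_orbit {s T : ℝ} (hs : 0 < s) (h : Function.Periodic (orbit s) T) :
    ∃ n : ℤ, T = n * orbitTime s (2 * π) := by
  have h0 : orbit s T = 0 := by rw [← zero_add T, h 0, orbit_zero]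
  -- A period also preserves the derivative, which at time `0` is `s`; this excludes phases that are
  -- odd multiples of `π`.
  have h1 : s * cos (phase s T) = s := by
    have e1 := (hasDerivAt_orbit s (0 + T)).comp_add_const 0 T
    rw [show (fun x => orbit s (x + T)) = orbit s from funext h] at e1
    have := e1.unique (hasDerivAt_orbit s 0)
    simpa [phase_zero] using this
  have h2 : cos (phase s T) = 1 := by
    field_simp at h1
    exact h1
  obtain ⟨n, hn⟩ := (Real.cos_eq_one_iff _).1 h2
  refine ⟨n, ?_⟩
  rw [← orbitTime_zsmul, hn, orbitTime_phase]

theorem orbitTime_two_pi_pos (s : ℝ) : 0 < orbitTime s (2 * π) := by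
  rw [← orbitTime_zero s]
  exact strictMono_orbitTime s two_pi_pos

theorem periodic_add_const_iff {f : ℝ → ℝ} {c T : ℝ} :
    Function.Periodic (fun t => f (t + c)) T ↔ Function.Periodic f T := by
  constructor
  · intro h t
    have := h (t - c)
    simp only [sub_add_cancel] at this
    rw [← this]
    congr 1
    ring
  · intro h t
    change f (t + T + c) = f (t + c)
    rw [← h (t + c)]
    congr 1
    ring

theorem hasLeastPeriod_orbit_add {s : ℝ} (hs : 0 < s) (c : ℝ) :
    HasLeastPeriod (fun t => orbit s (t + c)) (orbitTime s (2 * π)) := by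
  refine ⟨⟨orbitTime_two_pi_pos s, periodic_add_const_iff.2 (periodic_orbit s)⟩, ?_⟩
  rintro T ⟨hT, hper⟩
  obtain ⟨n, rfl⟩ := eq_mul_of_periodic_orbit hs (periodic_add_const_iff.1 hper)
  have h0 := orbitTime_two_pi_pos s
  have hn : (0 : ℝ) < n := pos_of_mul_pos_left hT h0.le
  have hn1 : (1 : ℝ) ≤ n := by exact_mod_cast hn
  nlinarith

theorem not_hasLeastPeriod_const (a T : ℝ) : ¬ HasLeastPeriod (fun _ => a) T := by
  rintro ⟨⟨h0, -⟩, h⟩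
  have : T ≤ T / 2 := h ⟨by linarith, fun _ => rfl⟩
  linarith

/-! ### The period as a function of the initial slope -/

theorem strictAntiOn_period : StrictAntiOn (fun s => orbitTime s (2 * π)) (Set.Ici 0) := by
  intro a ha b _ hab
  have ha' : 0 ≤ a := ha
  have hsq : a ^ 2 < b ^ 2 := by nlinarith
  -- The integrands are compared pointwise, with equality only where the sine vanishes; `π / 2` is a
  -- point of strict inequality.
  refine integral_lt_integral_of_continuousOn_of_le_of_exists_lt two_pi_pos
    (continuous_phaseSlowness_mul_sin b).continuousOn
    (continuous_phaseSlowness_mul_sin a).continuousOn (fun x _ => ?_)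
    ⟨π / 2, ⟨by positivity, by linarith [pi_pos]⟩, ?_⟩
  · rcases eq_or_ne (sin x) 0 with h | h
    · simp [h]
    · refine (phaseSlowness_lt ?_).le
      rw [mul_pow, mul_pow]
      exact mul_lt_mul_of_pos_right hsq (by positivity)
  · simpa using phaseSlowness_lt hsq

theorem period_zero : orbitTime 0 (2 * π) = 2 * π := by
  simp [orbitTime, phaseSlowness_zero]

theorem continuous_period : Continuous fun s => orbitTime s (2 * π) :=
  continuous_parametric_intervalIntegral_of_continuous'
    (f := fun s x => phaseSlowness (s * sin x))
    (continuous_phaseSlowness.comp (by fun_prop)) _ _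

theorem tendsto_phaseSlowness : Tendsto phaseSlowness (cocompact ℝ) (𝓝 0) := by
  have h1 : Tendsto (fun y : ℝ => ‖y‖) (cocompact ℝ) atTop := tendsto_norm_cocompact_atTop
  have h2 : Tendsto ampR (cocompact ℝ) atTop := by
    refine tendsto_atTop_mono (fun y => ?_) h1
    rw [Real.norm_eq_abs, ampR]
    refine Real.abs_le_sqrt ?_
    nlinarith [sq_nonneg y]
  have h3 : Tendsto (fun y => √(ampR y)⁻¹) (cocompact ℝ) (𝓝 0) := by
    have := (continuous_sqrt.tendsto 0).comp h2.inv_tendsto_atTop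
    rwa [Real.sqrt_zero] at this
  exact squeeze_zero (fun y => (phaseSlowness_pos y).le)
    (fun y => Real.le_sqrt_of_sq_le (phaseSlowness_sq_le y)) h3

/-- Dominated convergence with bound `1`: the integrand tends to `0` wherever `sin x ≠ 0`, hence
almost everywhere. -/
theorem tendsto_period : Tendsto (fun s => orbitTime s (2 * π)) atTop (𝓝 0) := by
  have : Tendsto (fun s => ∫ x in (0 : ℝ)..2 * π, phaseSlowness (s * sin x)) atTop
      (𝓝 (∫ _ in (0 : ℝ)..2 * π, (0 : ℝ))) := by
    refine tendsto_integral_filter_of_dominated_convergence (fun _ => 1)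
      (Eventually.of_forall fun s =>
        (continuous_phaseSlowness_mul_sin s).aestronglyMeasurable)
      (Eventually.of_forall fun s => Eventually.of_forall fun x _ => ?_)
      intervalIntegrable_const ?_
    · rw [Real.norm_eq_abs, abs_of_pos (phaseSlowness_pos _)]
      exact phaseSlowness_le_one _
    · have hnull : ∀ᵐ x : ℝ, x ∉ {x : ℝ | sin x = 0} := by
        refine (Set.Countable.ae_notMem ?_ volume)
        refine (Set.countable_range fun n : ℤ => (n : ℝ) * π).mono ?_
        intro x hx
        exact Real.sin_eq_zero_iff.1 hx
      filter_upwards [hnull] with x hx _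
      refine tendsto_phaseSlowness.comp ?_
      have hx' : 0 < |sin x| := abs_pos.2 hx
      rw [← Metric.cobounded_eq_cocompact, ← comap_norm_atTop, tendsto_comap_iff]
      have : Tendsto (fun s : ℝ => |s| * |sin x|) atTop atTop :=
        tendsto_abs_atTop_atTop.atTop_mul_const hx'
      simpa [Function.comp_def, abs_mul] using this
  rwa [intervalIntegral.integral_zero] at this

theorem exists_period_eq {T : ℝ} (h0 : 0 < T) (h1 : T < 2 * π) :
    ∃ s : ℝ, 0 < s ∧ orbitTime s (2 * π) = T := by
  obtain ⟨b, hb, hb0⟩ := ((tendsto_period.eventually (gt_mem_nhds h0)).and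
    (eventually_ge_atTop (0 : ℝ))).exists
  obtain ⟨s, hs, hsT⟩ := intermediate_value_Icc' hb0 continuous_period.continuousOn
    (show T ∈ Set.Icc _ _ from ⟨hb.le, by rw [period_zero]; exact h1.le⟩)
  refine ⟨s, lt_of_le_of_ne hs.1 ?_, hsT⟩
  rintro rfl
  simp only [period_zero] at hsT
  exact h1.ne' hsT

theorem period_lt {s : ℝ} (hs : 0 < s) : orbitTime s (2 * π) < 2 * π := by
  have := strictAntiOn_period (Set.self_mem_Ici) (Set.mem_Ici.2 hs.le) hs
  simpa only [period_zero] using this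

theorem eq_of_period_eq {a b : ℝ} (ha : 0 < a) (hb : 0 < b)
    (h : orbitTime a (2 * π) = orbitTime b (2 * π)) : a = b :=
  strictAntiOn_period.injOn (Set.mem_Ici.2 ha.le) (Set.mem_Ici.2 hb.le) h

/-! ### Solutions whose least period is `2π / k` -/

theorem two_pi_div_lt {k : ℕ} (hk : 2 ≤ k) : 0 < 2 * π / k ∧ 2 * π / k < 2 * π := by
  have hk' : (2 : ℝ) ≤ k := by exact_mod_cast hk
  have := pi_pos
  refine ⟨by positivity, ?_⟩
  rw [div_lt_iff₀ (by positivity)]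
  nlinarith

/-- The initial slope of the solution of least period `2π / k`. -/
noncomputable def slopeOf (k : ℕ) : ℝ :=
  open Classical in if hk : 2 ≤ k then
    (exists_period_eq (two_pi_div_lt hk).1 (two_pi_div_lt hk).2).choose else 0

theorem slopeOf_spec {k : ℕ} (hk : 2 ≤ k) :
    0 < slopeOf k ∧ orbitTime (slopeOf k) (2 * π) = 2 * π / k := by
  rw [slopeOf, dif_pos hk]
  exact (exists_period_eq (two_pi_div_lt hk).1 (two_pi_div_lt hk).2).choose_spec

theorem SolvesODE.exists_eq_orbit_slopeOf {v : ℝ → ℝ} (hv : SolvesODE v) {k : ℕ} (hk : 2 ≤ k)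
    (hT : HasLeastPeriod v (2 * π / k)) : ∃ c : ℝ, v = fun t => orbit (slopeOf k) (t + c) := by
  obtain ⟨s, hs, c, rfl⟩ := hv.exists_eq_orbit
  rcases hs.eq_or_lt with rfl | hs
  · simp only [orbit_zero_left] at hT
    exact (not_hasLeastPeriod_const _ _ hT).elim
  · have e := (hasLeastPeriod_orbit_add hs c).unique hT
    rw [← (slopeOf_spec hk).2] at e
    exact ⟨c, by rw [eq_of_period_eq hs (slopeOf_spec hk).1 e]⟩

/-- At a zero the phase is a multiple of `π`, so the slope there is `s` or `-s`. The equation is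
odd, and uniqueness identifies the translate with `orbit s` or its negative. -/
theorem orbit_add_of_eq_zero {s c : ℝ} (h : orbit s c = 0) :
    (fun t => orbit s (t + c)) = orbit s ∨ (fun t => orbit s (t + c)) = -orbit s := by
  have hs : s * sin (phase s c) = 0 := amplitude_eq_zero_iff.1 h
  rcases mul_eq_zero.1 hs with rfl | hsin
  · left
    funext t
    simp [orbit_zero_left]
  have h1 := fun t => (hasDerivAt_orbit s (t + c)).comp_add_const t c
  have h2 := fun t => (hasDerivAt_orbit_slope s (t + c)).comp_add_const t c
  rcases Real.sin_eq_zero_iff_cos_eq.1 hsin with hc | hc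
  · left
    exact eq_of_initial_data h1 h2 (hasDerivAt_orbit s) (hasDerivAt_orbit_slope s)
      (by simp [h, orbit_zero]) (by simp [hc, phase_zero])
  · right
    refine eq_of_initial_data h1 h2 (fun t => (hasDerivAt_orbit s t).neg)
      (fun t => ?_) (by simp [h, orbit_zero]) (by simp [hc, phase_zero])
    refine (hasDerivAt_orbit_slope s t).neg.congr_deriv ?_
    simp only [Pi.neg_apply]
    ring

/-- A nonconstant `2π`-periodic solution is a translate of one of least period `2π / k`. -/
theorem SolvesODE.exists_of_periodic {v : ℝ → ℝ} (hv : SolvesODE v)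
    (hper : Function.Periodic v (2 * π)) (hne : ∃ t, v t ≠ 0) :
    ∃ k : ℕ, 2 ≤ k ∧ ∃ c : ℝ, v = fun t => orbit (slopeOf k) (t + c) := by
  obtain ⟨s, hs, c, rfl⟩ := hv.exists_eq_orbit
  rcases hs.eq_or_lt with rfl | hs
  · simp [orbit_zero_left] at hne
  obtain ⟨n, hn⟩ := eq_mul_of_periodic_orbit hs (periodic_add_const_iff.1 hper)
  have h0 := orbitTime_two_pi_pos s
  have h1 := period_lt hs
  -- A positive slope makes the least period strictly shorter than `2π`, so `2π` is at least twice
  -- it. This is why `k = 1` does not occur.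
  have hn1 : (1 : ℝ) < n := by
    by_contra hle
    nlinarith [pi_pos]
  have hn2 : 2 ≤ n := by exact_mod_cast hn1
  lift n to ℕ using by omega
  have hk : 2 ≤ n := by exact_mod_cast hn2
  refine ⟨n, hk, c, ?_⟩
  have hT : orbitTime s (2 * π) = orbitTime (slopeOf n) (2 * π) := by
    rw [(slopeOf_spec hk).2]
    push_cast at hn hn1
    rw [eq_div_iff (by linarith)]
    linarith
  rw [← eq_of_period_eq hs (slopeOf_spec hk).1 hT]

/-! ### Periodic solutions of `w'' + w = w³` -/

theorem Function.Periodic.eq_of_monotone {f : ℝ → ℝ} {T : ℝ} (hf : Function.Periodic f T)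
    (hT : 0 < T) (hm : Monotone f) (x y : ℝ) : f x = f y := by
  have key : ∀ x y, f x ≤ f y := fun x y => by
    obtain ⟨z, hz, e⟩ := hf.exists_mem_Ico hT y x
    rw [e]
    exact hm hz.1
  exact le_antisymm (key x y) (key y x)

theorem Function.Periodic.of_hasDerivAt {f g : ℝ → ℝ} {T : ℝ} (hf : Function.Periodic f T)
    (h : ∀ t, HasDerivAt f (g t) t) : Function.Periodic g T := fun t => by
  have e := (h (t + T)).comp_add_const t T
  rw [show (fun x => f (x + T)) = f from funext hf] at e
  exact e.unique (h t)

theorem eventually_pos_of_hasDerivAt_pos {f : ℝ → ℝ} {f' a : ℝ} (h : HasDerivAt f f' a)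
    (h0 : f a = 0) (hpos : 0 < f') :
    (∀ᶠ t in 𝓝[>] a, 0 < f t) ∧ ∀ᶠ t in 𝓝[<] a, f t < 0 := by
  have hs := (hasDerivAt_iff_tendsto_slope.1 h).eventually (lt_mem_nhds hpos)
  constructor
  · filter_upwards [hs.filter_mono (nhdsWithin_mono a fun t (ht : a < t) => ht.ne'),
      self_mem_nhdsWithin] with t ht hta
    rw [slope_def_field, h0, sub_zero] at ht
    exact (div_pos_iff_of_pos_right (sub_pos.2 hta)).1 ht
  · filter_upwards [hs.filter_mono (nhdsWithin_mono a fun t (ht : t < a) => ht.ne),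
      self_mem_nhdsWithin] with t ht hta
    rw [slope_def_field, h0, sub_zero] at ht
    have h1 : t - a < 0 := sub_neg.2 hta
    by_contra hle
    exact absurd ht (not_lt.2 (div_nonpos_of_nonneg_of_nonpos (not_lt.1 hle) h1.le))

section Defocusing

variable {w p : ℝ → ℝ}

theorem defocusing_neg (hw : ∀ t, HasDerivAt w (p t) t)
    (hp : ∀ t, HasDerivAt p (-w t + w t ^ 3) t) :
    (∀ t, HasDerivAt (fun t => -w t) (-p t) t) ∧
      ∀ t, HasDerivAt (fun t => -p t) (-(-w t) + (-w t) ^ 3) t :=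
  ⟨fun t => (hw t).neg, fun t => (hp t).neg.congr_deriv (by ring)⟩

/-- Since `w'' = w (w + 1)(w - 1)`, the function `w' (w - 1)` has derivative `w'² + w (w + 1)(w -
1)² ≥ 0`. Being monotone and periodic it is constant, so both terms vanish and `w' = 0`. -/
theorem defocusing_eq_of_pos (hw : ∀ t, HasDerivAt w (p t) t)
    (hp : ∀ t, HasDerivAt p (-w t + w t ^ 3) t) (hper : Function.Periodic w (2 * π))
    (hpos : ∀ t, 0 < w t) (x y : ℝ) : w x = w y := by
  have hpp := hper.of_hasDerivAt hw
  have hd : ∀ t, HasDerivAt (fun t => p t * (w t - 1))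
      (p t ^ 2 + w t * (w t + 1) * (w t - 1) ^ 2) t := fun t =>
    ((hp t).mul ((hw t).sub_const 1)).congr_deriv (by ring)
  have hmono : Monotone fun t => p t * (w t - 1) :=
    monotone_of_deriv_nonneg (fun t => (hd t).differentiableAt) fun t => by
      rw [(hd t).deriv]
      have := hpos t
      positivity
  have hP : Function.Periodic (fun t => p t * (w t - 1)) (2 * π) := fun t => by
    simp only [hpp t, hper t]
  have hconst : (fun t => p t * (w t - 1)) = fun _ => p 0 * (w 0 - 1) :=
    funext fun t => hP.eq_of_monotone two_pi_pos hmono t 0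
  have hp0 : ∀ t, p t = 0 := fun t => by
    have e := hd t
    rw [hconst] at e
    have e0 := e.unique (hasDerivAt_const t _)
    have h1 : 0 ≤ w t * (w t + 1) * (w t - 1) ^ 2 := by
      have := hpos t
      positivity
    have : p t ^ 2 = 0 := le_antisymm (by linarith) (sq_nonneg _)
    exact pow_eq_zero_iff two_ne_zero |>.1 this
  exact is_const_of_deriv_eq_zero (fun t => (hw t).differentiableAt)
    (fun t => by rw [(hw t).deriv, hp0]) x y

/-- Consecutive zeros of a solution of `w'' + w = w³` are more than `π` apart. -/
theorem defocusing_zero_gap (hw : ∀ t, HasDerivAt w (p t) t)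
    (hp : ∀ t, HasDerivAt p (-w t + w t ^ 3) t) {a b : ℝ} (hab : a < b) (hwa : w a = 0)
    (hwb : w b = 0) (hpa : 0 < p a) : a + π < b := by
  by_contra hle
  rw [not_lt] at hle
  have hcont : Continuous w := continuous_iff_continuousAt.2 fun t => (hw t).continuousAt
  obtain ⟨m, hm, hmpos⟩ := (mem_nhdsGT_iff_exists_Ioo_subset' hab).1
    (eventually_pos_of_hasDerivAt_pos (hw a) hwa hpa).1
  have ham : a < m := hm
  have hmb : m ≤ b := by
    by_contra h
    have : 0 < w b := hmpos ⟨hab, not_le.1 h⟩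
    linarith
  -- Positivity on `(a, m)` keeps the zeros in `(a, b]` away from `a`, so there is a first one, `c`.
  have hcpt : IsCompact (Set.Icc m b ∩ w ⁻¹' {0}) :=
    isCompact_Icc.inter_right (isClosed_singleton.preimage hcont)
  obtain ⟨c, ⟨⟨hmc, hcb⟩, hwc⟩, hleast⟩ :=
    hcpt.exists_isLeast ⟨b, ⟨hmb, le_rfl⟩, hwb⟩
  have hwc : w c = 0 := hwc
  have hac : a < c := ham.trans_le hmc
  have hwpos : ∀ t ∈ Set.Ioo a c, 0 < w t := by
    intro t ht
    by_contra hneg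
    rw [not_lt] at hneg
    have hmt : m ≤ t := by
      by_contra h
      have : 0 < w t := hmpos ⟨ht.1, not_le.1 h⟩
      linarith
    let x := (a + m) / 2
    have hx : 0 < w x := hmpos ⟨by simp only [x]; linarith, by simp only [x]; linarith⟩
    have hxm : x < m := by simp only [x]; linarith
    have hxa : a < x := by simp only [x]; linarith
    obtain ⟨z, hz, hwz⟩ := intermediate_value_Icc' (hxm.le.trans hmt) hcont.continuousOn
      (show (0 : ℝ) ∈ Set.Icc _ _ from ⟨hneg, hx.le⟩)
    have hmz : m ≤ z := by
      by_contra h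
      have : 0 < w z := hmpos ⟨hxa.trans_le hz.1, not_le.1 h⟩
      linarith
    have := hleast ⟨⟨hmz, hz.2.trans (ht.2.le.trans hcb)⟩, hwz⟩
    linarith [hz.2, ht.2]
  have hpc : p c ≤ 0 := by
    by_contra h
    obtain ⟨t, ht, ht'⟩ := ((eventually_pos_of_hasDerivAt_pos (hw c) hwc (not_le.1 h)).2.and
      (Ioo_mem_nhdsLT hac)).exists
    exact absurd ht (not_lt.2 (hwpos t ht').le)
  -- Sturm comparison: the Wronskian of `w` with `sin (t - a)`, a solution of `y'' + y = 0`, has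
  -- derivative `w³ sin (t - a)`. If `c ≤ a + π` it increases strictly from `0`, yet its value at
  -- `c` is `p c * sin (c - a) ≤ 0`.
  have hd : ∀ t, HasDerivAt (fun t => p t * sin (t - a) - w t * cos (t - a))
      (w t ^ 3 * sin (t - a)) t := fun t => by
    have h1 := ((hasDerivAt_id t).sub_const a).sin
    have h2 := ((hasDerivAt_id t).sub_const a).cos
    refine (((hp t).mul h1).sub ((hw t).mul h2)).congr_deriv ?_
    simp only [id]
    ring
  have hmono : StrictMonoOn (fun t => p t * sin (t - a) - w t * cos (t - a)) (Set.Icc a c) := by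
    refine strictMonoOn_of_deriv_pos (convex_Icc a c)
      (fun t _ => (hd t).continuousAt.continuousWithinAt) fun t ht => ?_
    rw [interior_Icc] at ht
    rw [(hd t).deriv]
    have h1 := hwpos t ht
    have h2 : 0 < sin (t - a) := sin_pos_of_pos_of_lt_pi (by linarith [ht.1]) (by linarith [ht.2])
    positivity
  have := hmono (Set.left_mem_Icc.2 hac.le) (Set.right_mem_Icc.2 hac.le) hac
  simp only [sub_self, sin_zero, mul_zero, cos_zero, hwa, hwc, zero_mul, sub_zero] at this
  have hs : 0 ≤ sin (c - a) := sin_nonneg_of_nonneg_of_le_pi (by linarith) (by linarith)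
  nlinarith

/-- The energy `p² + w² - w⁴/2` does not bound `w` here. Periodicity does, so `w'' = (-1 + w²) w` is
linear with bounded coefficient. -/
theorem defocusing_eq_zero (hw : ∀ t, HasDerivAt w (p t) t)
    (hp : ∀ t, HasDerivAt p (-w t + w t ^ 3) t) (hper : Function.Periodic w (2 * π)) {a : ℝ}
    (hwa : w a = 0) (hpa : p a = 0) (t : ℝ) : w t = 0 := by
  have hcont : Continuous w := continuous_iff_continuousAt.2 fun t => (hw t).continuousAt
  obtain ⟨C, hC⟩ := (isCompact_Icc (a := (0 : ℝ)) (b := 2 * π)).exists_bound_of_continuousOn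
    (f := fun t => -1 + w t ^ 2) (by fun_prop)
  refine eq_zero_of_second_order_linear (c := fun t => -1 + w t ^ 2) (C := C) hw
    (fun t => (hp t).congr_deriv (by ring)) (fun t => ?_) hwa hpa t
  obtain ⟨y, hy, e⟩ := hper.exists_mem_Ico₀ two_pi_pos t
  rw [e]
  exact hC y ⟨hy.1, hy.2.le⟩

/-- The solution rises through zero at `a` and at `a + 2π`, so it has a zero `b` in between. By
uniqueness the slope at `b` is nonzero, and the gap from `b` to `a + 2π` exceeds `π`, as does that
from `a` to `b`: too much for an interval of length `2π`. -/
theorem defocusing_no_zero (hw : ∀ t, HasDerivAt w (p t) t)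
    (hp : ∀ t, HasDerivAt p (-w t + w t ^ 3) t) (hper : Function.Periodic w (2 * π)) {a : ℝ}
    (hwa : w a = 0) (hpa : 0 < p a) : False := by
  have hcont : Continuous w := continuous_iff_continuousAt.2 fun t => (hw t).continuousAt
  have hpp := hper.of_hasDerivAt hw
  have hpi := pi_pos
  have hwa' : w (a + 2 * π) = 0 := by rw [hper, hwa]
  have hpa' : 0 < p (a + 2 * π) := by rw [hpp]; exact hpa
  obtain ⟨x, hx, hxI⟩ := ((eventually_pos_of_hasDerivAt_pos (hw a) hwa hpa).1.and
    (Ioo_mem_nhdsGT (show a < a + π by linarith))).exists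
  obtain ⟨y, hy, hyI⟩ := ((eventually_pos_of_hasDerivAt_pos (hw _) hwa' hpa').2.and
    (Ioo_mem_nhdsLT (show a + π < a + 2 * π by linarith))).exists
  obtain ⟨b, hb, hwb⟩ := intermediate_value_Icc' (hxI.2.le.trans hyI.1.le) hcont.continuousOn
    (show (0 : ℝ) ∈ Set.Icc _ _ from ⟨hy.le, hx.le⟩)
  have hab : a < b := hxI.1.trans_le hb.1
  have hb2 : b < a + 2 * π := hb.2.trans_lt hyI.2
  have g1 := defocusing_zero_gap hw hp hab hwa hwb hpa
  rcases lt_trichotomy (p b) 0 with h | h | h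
  · obtain ⟨n1, n2⟩ := defocusing_neg hw hp
    have := defocusing_zero_gap n1 n2 hb2 (by simp [hwb]) (by simp [hwa']) (by simpa using h)
    linarith
  · have := defocusing_eq_zero hw hp hper hwb h x
    linarith
  · have := defocusing_zero_gap hw hp hb2 hwb hwa' h
    linarith

/-- A `2π`-periodic solution of `w'' + w = w³` is constant. -/
theorem defocusing_eq (hw : ∀ t, HasDerivAt w (p t) t)
    (hp : ∀ t, HasDerivAt p (-w t + w t ^ 3) t) (hper : Function.Periodic w (2 * π))
    (x y : ℝ) : w x = w y := by
  have hcont : Continuous w := continuous_iff_continuousAt.2 fun t => (hw t).continuousAt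
  obtain ⟨n1, n2⟩ := defocusing_neg hw hp
  have nper : Function.Periodic (fun t => -w t) (2 * π) := fun t => by simp only [hper t]
  by_cases hz : ∃ a, w a = 0
  · obtain ⟨a, ha⟩ := hz
    rcases lt_trichotomy (p a) 0 with h | h | h
    · exact (defocusing_no_zero n1 n2 nper (a := a) (by simp [ha]) (by simpa using h)).elim
    · rw [defocusing_eq_zero hw hp hper ha h x, defocusing_eq_zero hw hp hper ha h y]
    · exact (defocusing_no_zero hw hp hper ha h).elim
  · push Not at hz
    rcases lt_or_gt_of_ne (hz 0) with h | h
    · have hneg : ∀ t, w t < 0 := fun t => by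
        by_contra hle
        obtain ⟨c, hc⟩ := mem_range_of_exists_le_of_exists_ge hcont ⟨0, h.le⟩ ⟨t, not_lt.1 hle⟩
        exact hz c hc
      have := defocusing_eq_of_pos n1 n2 nper (fun t => by linarith [hneg t]) x y
      linarith
    · have hpos : ∀ t, 0 < w t := fun t => by
        by_contra hle
        obtain ⟨c, hc⟩ := mem_range_of_exists_le_of_exists_ge hcont ⟨t, not_lt.1 hle⟩ ⟨0, h.le⟩
        exact hz c hc
      exact defocusing_eq_of_pos hw hp hper hpos x y

end Defocusing

/-! ### The Laplacian in polar coordinates -/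

/-- The acceleration term matters: meridians and parallels are curved in space, and the acceleration
of the parallels yields the first-order term of the polar Laplacian. -/
theorem deriv_comp_curve {E : Type*} [NormedAddCommGroup E] [NormedSpace ℝ E] {U : E → ℝ}
    {γ γ' : ℝ → E} {γ'' : E} {t₀ : ℝ} (hU : ContDiffAt ℝ 2 U (γ t₀))
    (hγ : ∀ t, HasDerivAt γ (γ' t) t) (hγ' : HasDerivAt γ' γ'' t₀) :
    deriv (fun t => U (γ t)) t₀ = fderiv ℝ U (γ t₀) (γ' t₀) ∧
    deriv (deriv fun t => U (γ t)) t₀ =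
      iteratedFDeriv ℝ 2 U (γ t₀) ![γ' t₀, γ' t₀] + fderiv ℝ U (γ t₀) γ'' := by
  have hev : ∀ᶠ t in 𝓝 t₀, HasDerivAt (fun t => U (γ t)) (fderiv ℝ U (γ t) (γ' t)) t := by
    have h1 : ∀ᶠ x in 𝓝 (γ t₀), ContDiffAt ℝ 2 U x := hU.eventually (by simp)
    filter_upwards [(hγ t₀).continuousAt.eventually h1] with t ht
    exact (ht.differentiableAt (by norm_num)).hasFDerivAt.comp_hasDerivAt t (hγ t)
  have h2 : HasFDerivAt (fderiv ℝ U) (fderiv ℝ (fderiv ℝ U) (γ t₀)) (γ t₀) :=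
    ((hU.fderiv_right (m := 1) (by norm_num)).differentiableAt (by norm_num)).hasFDerivAt
  refine ⟨hev.self_of_nhds.deriv, ?_⟩
  have e : deriv (fun t => U (γ t)) =ᶠ[𝓝 t₀] fun t => fderiv ℝ U (γ t) (γ' t) :=
    hev.mono fun t ht => ht.deriv
  rw [e.deriv_eq, iteratedFDeriv_two_apply]
  exact ((h2.comp_hasDerivAt t₀ (hγ t₀)).clm_apply hγ').deriv

theorem hasDerivAt_vec3 {a b c : ℝ → ℝ} {a' b' c' t : ℝ} (ha : HasDerivAt a a' t)
    (hb : HasDerivAt b b' t) (hc : HasDerivAt c c' t) :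
    HasDerivAt (fun t => (!₂[a t, b t, c t] : E3)) !₂[a', b', c'] t := by
  have h : HasDerivAt (fun t => ![a t, b t, c t]) ![a', b', c'] t := by
    rw [hasDerivAt_pi]
    intro i
    fin_cases i
    · exact ha
    · exact hb
    · exact hc
  exact (PiLp.hasFDerivAt_toLp 2 _).comp_hasDerivAt t h

theorem norm_S2 (x : S2) : ‖(x : E3)‖ = 1 := mem_sphere_zero_iff_norm.1 x.2

theorem S2_ne_zero (x : S2) : (x : E3) ≠ 0 := by
  intro h
  have := norm_S2 x
  simp [h] at this

theorem radialExtension_smul (u : S2 → ℝ) (x : S2) {t : ℝ} (ht : 0 < t) :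
    radialExtension u (t • (x : E3)) = u x := by
  rw [radialExtension, dif_neg (smul_ne_zero ht.ne' (S2_ne_zero x))]
  congr 1
  ext1
  simp only [norm_smul, norm_S2, mul_one, Real.norm_eq_abs, abs_of_pos ht, smul_smul]
  rw [inv_mul_cancel₀ ht.ne', one_smul]

theorem radialExtension_coe (u : S2 → ℝ) (x : S2) : radialExtension u x = u x := by
  simpa using radialExtension_smul u x one_pos

/-- The radial extension is constant along rays, to second order. -/
theorem radialExtension_deriv_ray {u : S2 → ℝ} {x : S2}
    (hU : ContDiffAt ℝ 2 (radialExtension u) (x : E3)) :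
    fderiv ℝ (radialExtension u) (x : E3) x = 0 ∧
      iteratedFDeriv ℝ 2 (radialExtension u) (x : E3) ![(x : E3), (x : E3)] = 0 := by
  have hγ : ∀ t : ℝ, HasDerivAt (fun t : ℝ => t • (x : E3)) (x : E3) t := fun t => by
    simpa using (hasDerivAt_id t).smul_const (x : E3)
  have hev : (fun t : ℝ => radialExtension u (t • (x : E3))) =ᶠ[𝓝 1] fun _ => u x := by
    filter_upwards [lt_mem_nhds one_pos] with t ht using radialExtension_smul u x ht
  obtain ⟨h1, h2⟩ := deriv_comp_curve (U := radialExtension u) (γ := fun t : ℝ => t • (x : E3))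
    (γ' := fun _ => (x : E3)) (t₀ := 1) (γ'' := 0) (by simpa using hU) hγ (hasDerivAt_const _ _)
  rw [hev.deriv_eq, deriv_const] at h1
  rw [hev.deriv.deriv_eq] at h2
  simp only [one_smul, deriv_const', deriv_const, map_zero, add_zero] at h1 h2
  exact ⟨h1.symm, h2.symm⟩

theorem inner_vec3 (a b c a' b' c' : ℝ) :
    inner ℝ (!₂[a, b, c] : E3) !₂[a', b', c'] = a * a' + b * b' + c * c' := by
  simp [PiLp.inner_apply, Fin.sum_univ_three]
  ring

theorem orthonormal_polarFrame (r θ : ℝ) :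
    Orthonormal ℝ ![(!₂[sin r * cos θ, sin r * sin θ, cos r] : E3),
      !₂[cos r * cos θ, cos r * sin θ, -sin r], !₂[-sin θ, cos θ, 0]] := by
  have h1 := sin_sq_add_cos_sq r
  have h2 := sin_sq_add_cos_sq θ
  rw [orthonormal_iff_ite]
  intro i j
  fin_cases i <;> fin_cases j <;> refine (inner_vec3 _ _ _ _ _ _).trans ?_ <;> norm_num
  · linear_combination h1 + sin r ^ 2 * h2
  · linear_combination sin r * cos r * h2
  · ring
  · linear_combination sin r * cos r * h2
  · linear_combination h1 + cos r ^ 2 * h2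
  · ring
  · ring
  · ring
  · linear_combination h2

/-- The Euclidean Laplacian is the trace of the Hessian in the orthonormal frame of the radial
direction `X`, the meridian direction `Y` and the parallel direction `Z`. The `X` contribution
vanishes because the extension is constant along rays. -/
theorem sphereLaplacian_polarPoint {u : S2 → ℝ} {r θ : ℝ} (hr : sin r ≠ 0)
    (hU : ContDiffAt ℝ 2 (radialExtension u) (polarPoint r θ : E3)) :
    sphereLaplacian u (polarPoint r θ) =
      deriv (deriv fun r => u (polarPoint r θ)) r +
      cos r / sin r * deriv (fun r => u (polarPoint r θ)) r +
      deriv (deriv fun θ => u (polarPoint r θ)) θ / sin r ^ 2 := by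
  set U := radialExtension u with hUdef
  set X : E3 := (polarPoint r θ : E3) with hX
  set Y : E3 := !₂[cos r * cos θ, cos r * sin θ, -sin r] with hY
  set Z : E3 := !₂[-sin θ, cos θ, 0] with hZ
  obtain ⟨hray1, hray2⟩ := radialExtension_deriv_ray hU
  change fderiv ℝ U X X = 0 at hray1
  change iteratedFDeriv ℝ 2 U X ![X, X] = 0 at hray2
  have hlap : sphereLaplacian u (polarPoint r θ) = iteratedFDeriv ℝ 2 U X ![X, X] +
      iteratedFDeriv ℝ 2 U X ![Y, Y] + iteratedFDeriv ℝ 2 U X ![Z, Z] := by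
    have ho := orthonormal_polarFrame r θ
    let b := OrthonormalBasis.mk ho (ho.linearIndependent.span_eq_top_of_card_eq_finrank
      (by simp)).ge
    rw [sphereLaplacian, InnerProductSpace.laplacian_eq_iteratedFDeriv_orthonormalBasis _ b]
    simp only [b, OrthonormalBasis.coe_mk, Fin.sum_univ_three]
    rfl
  have hu : ∀ r θ, u (polarPoint r θ) = U (polarPoint r θ : E3) := fun r θ =>
    (radialExtension_coe u _).symm
  simp only [hu]
  obtain ⟨r1, r2⟩ := deriv_comp_curve (U := U) (t₀ := r) (γ'' := -X)
    (γ := fun r => (polarPoint r θ : E3))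
    (γ' := fun r => !₂[cos r * cos θ, cos r * sin θ, -sin r]) hU
    (fun t => hasDerivAt_vec3 ((hasDerivAt_sin t).mul_const _) ((hasDerivAt_sin t).mul_const _)
      (hasDerivAt_cos t))
    (by
      have := hasDerivAt_vec3 ((hasDerivAt_cos r).mul_const (cos θ))
        ((hasDerivAt_cos r).mul_const (sin θ)) (hasDerivAt_sin r).neg
      refine this.congr_deriv ?_
      ext i
      fin_cases i <;> simp [hX, polarPoint])
  obtain ⟨-, t2⟩ := deriv_comp_curve (U := U) (t₀ := θ)
    -- The acceleration points to the axis: `(cos θ, sin θ, 0) = sin r • X + cos r • Y`. Its `X`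
    -- part is annihilated by the differential, and its `Y` part gives the term with `cos r / sin
    -- r`.
    (γ'' := -(sin r) • (sin r • X + cos r • Y))
    (γ := fun θ => (polarPoint r θ : E3))
    (γ' := fun θ => sin r • !₂[-sin θ, cos θ, 0]) hU
    (fun t => by
      refine (hasDerivAt_vec3 ((hasDerivAt_cos t).const_mul _) ((hasDerivAt_sin t).const_mul _)
        (hasDerivAt_const t (cos r))).congr_deriv ?_
      ext i
      fin_cases i <;> simp)
    (by
      refine ((hasDerivAt_vec3 (hasDerivAt_sin θ).neg (hasDerivAt_cos θ)
        (hasDerivAt_const θ (0 : ℝ))).const_smul (sin r)).congr_deriv ?_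
      have h1 := sin_sq_add_cos_sq r
      ext i
      fin_cases i <;> simp [hX, hY, polarPoint]
      · linear_combination sin r * cos θ * h1
      · linear_combination sin r * sin θ * h1
      · ring)
  have hZZ : iteratedFDeriv ℝ 2 U X ![sin r • Z, sin r • Z] =
      sin r ^ 2 * iteratedFDeriv ℝ 2 U X ![Z, Z] := by
    simp only [iteratedFDeriv_two_apply, Matrix.cons_val_zero, Matrix.cons_val_one, map_smul,
      _root_.smul_apply, smul_eq_mul]
    ring
  simp only [← hX, ← hY, ← hZ] at r1 r2 t2
  rw [hZZ] at t2
  simp only [map_neg, map_smul, map_add, hray1, smul_eq_mul, neg_mul] at r2 t2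
  rw [hlap, r1, r2, t2, hray2]
  field_simp
  ring

/-! ### Polar coordinates and rotationally symmetric domains -/

theorem continuous_polarPoint_left (θ : ℝ) : Continuous fun r => polarPoint r θ := by
  refine Continuous.subtype_mk (continuous_iff_continuousAt.2 fun r => ?_) _
  exact (hasDerivAt_vec3 ((hasDerivAt_sin r).mul_const (cos θ))
    ((hasDerivAt_sin r).mul_const (sin θ)) (hasDerivAt_cos r)).continuousAt

theorem axialRotation_polarPoint (α r θ : ℝ) :
    axialRotation α (polarPoint r θ) = polarPoint r (θ + α) := by
  ext i
  fin_cases i <;> simp [axialRotation, polarPoint, cos_add, sin_add] <;> ring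

theorem norm_sq_E3 (x : E3) : ‖x‖ ^ 2 = x 0 ^ 2 + x 1 ^ 2 + x 2 ^ 2 := by
  rw [EuclideanSpace.norm_sq_eq, Fin.sum_univ_three]
  simp

/-- Spherical coordinates of a vector off the vertical axis, with a prescribed azimuth. -/
theorem exists_polar_angle {x : E3} {ρ θ : ℝ} (hρ : 0 < ρ) (h0 : x 0 = ρ * cos θ)
    (h1 : x 1 = ρ * sin θ) :
    ∃ r ∈ Set.Ioo 0 π, ρ = ‖x‖ * sin r ∧ x = ‖x‖ • (polarPoint r θ : E3) := by
  let z : ℂ := ⟨x 2, ρ⟩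
  have hz : ‖z‖ = ‖x‖ := by
    rw [← sq_eq_sq₀ (norm_nonneg _) (norm_nonneg _), norm_sq_E3, Complex.sq_norm,
      Complex.normSq_apply, h0, h1]
    simp only [z]
    linear_combination (-ρ ^ 2) * sin_sq_add_cos_sq θ
  have hs : ‖x‖ * sin z.arg = ρ := by rw [← hz, Complex.norm_mul_sin_arg]
  have hc : ‖x‖ * cos z.arg = x 2 := by rw [← hz, Complex.norm_mul_cos_arg]
  have hpos : 0 < sin z.arg := by
    by_contra h
    nlinarith [norm_nonneg x]
  refine ⟨z.arg, ⟨?_, ?_⟩, hs.symm, ?_⟩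
  · by_contra h
    have := sin_nonpos_of_nonpos_of_neg_pi_le (not_lt.1 h) (Complex.neg_pi_lt_arg z).le
    linarith
  · refine lt_of_le_of_ne (Complex.arg_le_pi z) fun h => ?_
    rw [h, sin_pi] at hpos
    exact lt_irrefl _ hpos
  · ext i
    fin_cases i
    · simp [polarPoint, h0]
      rw [← mul_assoc, hs]
    · simp [polarPoint, h1]
      rw [← mul_assoc, hs]
    · simp [polarPoint, hc]

theorem exists_eq_polarPoint (x : S2) : ∃ r ∈ Set.Icc 0 π, ∃ θ, x = polarPoint r θ := by
  have hnorm := norm_sq_E3 (x : E3)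
  rw [norm_S2, one_pow] at hnorm
  obtain ⟨z, hz0, hz1⟩ : ∃ z : ℂ, z.re = x.1 0 ∧ z.im = x.1 1 := ⟨⟨x.1 0, x.1 1⟩, rfl, rfl⟩
  obtain ⟨y, hy0, hy1⟩ : ∃ y : ℂ, y.re = x.1 2 ∧ y.im = ‖z‖ := ⟨⟨x.1 2, ‖z‖⟩, rfl, rfl⟩
  have hz : ‖z‖ ^ 2 = x.1 0 ^ 2 + x.1 1 ^ 2 := by
    rw [Complex.sq_norm, Complex.normSq_apply, hz0, hz1]
    ring
  have hy : ‖y‖ = 1 := by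
    rw [← sq_eq_sq₀ (norm_nonneg _) zero_le_one, Complex.sq_norm, Complex.normSq_apply, hy0, hy1]
    linear_combination hz - hnorm
  have hs : sin y.arg = ‖z‖ := by
    rw [← hy1, ← Complex.norm_mul_sin_arg y, hy, one_mul]
  have hc : cos y.arg = x.1 2 := by
    rw [← hy0, ← Complex.norm_mul_cos_arg y, hy, one_mul]
  refine ⟨y.arg, ⟨Complex.arg_nonneg_iff.2 (by rw [hy1]; exact norm_nonneg z),
    Complex.arg_le_pi y⟩, z.arg, ?_⟩
  ext i
  fin_cases i
  · change x.1 0 = sin y.arg * cos z.arg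
    rw [hs, Complex.norm_mul_cos_arg, hz0]
  · change x.1 1 = sin y.arg * sin z.arg
    rw [hs, Complex.norm_mul_sin_arg, hz1]
  · exact hc.symm

theorem sin_pos_of_mem {r : ℝ} (hr : r ∈ Set.Ioo 0 π) : 0 < sin r :=
  sin_pos_of_pos_of_lt_pi hr.1 hr.2

/-- The polar radii of the points of `Ω` other than the poles. -/
def radii (Ω : Set S2) : Set ℝ := {r | r ∈ Set.Ioo 0 π ∧ polarPoint r 0 ∈ Ω}

namespace IsRotSymmDomain

variable {Ω : Set S2}

theorem polarPoint_mem_iff (hΩ : IsRotSymmDomain Ω) (r θ θ' : ℝ) :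
    polarPoint r θ ∈ Ω ↔ polarPoint r θ' ∈ Ω := by
  have key : ∀ a b, polarPoint r a ∈ Ω → polarPoint r b ∈ Ω := fun a b h => by
    have := hΩ.rotation_mem (b - a) _ h
    rwa [axialRotation_polarPoint, add_sub_cancel] at this
  exact ⟨key _ _, key _ _⟩

theorem mem_of_mem_radii (hΩ : IsRotSymmDomain Ω) {r : ℝ} (hr : r ∈ radii Ω) (θ : ℝ) :
    polarPoint r θ ∈ Ω :=
  (hΩ.polarPoint_mem_iff r 0 θ).1 hr.2

theorem mem_radii (hΩ : IsRotSymmDomain Ω) {r θ : ℝ} (hr : r ∈ Set.Ioo 0 π)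
    (h : polarPoint r θ ∈ Ω) : r ∈ radii Ω :=
  ⟨hr, (hΩ.polarPoint_mem_iff r θ 0).1 h⟩

theorem isOpen_radii (hΩ : IsRotSymmDomain Ω) : IsOpen (radii Ω) :=
  isOpen_Ioo.inter (hΩ.isOpen.preimage (continuous_polarPoint_left 0))

theorem nonempty_radii (hΩ : IsRotSymmDomain Ω) : (radii Ω).Nonempty := by
  obtain ⟨x, hx⟩ := hΩ.isConnected.nonempty
  obtain ⟨r, hr, θ, rfl⟩ := exists_eq_polarPoint x
  -- The chosen point may be a pole; openness of `Ω` supplies a nearby radius strictly between `0`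
  -- and `π`.
  rw [← closure_Ioo pi_pos.ne] at hr
  obtain ⟨r', hr', hI⟩ := mem_closure_iff.1 hr _ (hΩ.isOpen.preimage
    (continuous_polarPoint_left θ)) hx
  exact ⟨r', hΩ.mem_radii hI hr'⟩

/-- The height `cos r` sends `Ω` to an interval and is injective on `[0, π]`. Arguing with all of
`Ω` avoids showing that it stays connected after the poles are removed. -/
theorem isPreconnected_radii (hΩ : IsRotSymmDomain Ω) : IsPreconnected (radii Ω) := by
  have hpre : IsPreconnected ((fun x : S2 => x.1 2) '' Ω) :=
    hΩ.isConnected.isPreconnected.image _ (by fun_prop)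
  refine (Set.ordConnected_def.2 ?_ : (radii Ω).OrdConnected).isPreconnected
  intro a ha b hb r hr
  have hrI : r ∈ Set.Ioo 0 π := ⟨ha.1.1.trans_le hr.1, hr.2.trans_lt hb.1.2⟩
  obtain ⟨x, hx, hx2⟩ := hpre.ordConnected.out
    (Set.mem_image_of_mem _ hb.2) (Set.mem_image_of_mem _ ha.2)
    (show cos r ∈ Set.Icc _ _ from
      ⟨cos_le_cos_of_nonneg_of_le_pi hrI.1.le hb.1.2.le hr.2,
        cos_le_cos_of_nonneg_of_le_pi ha.1.1.le hrI.2.le hr.1⟩)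
  obtain ⟨r', hr', θ, rfl⟩ := exists_eq_polarPoint x
  have hcos : cos r' = cos r := hx2
  have e : r' = r := injOn_cos hr' (Set.Ioo_subset_Icc_self hrI) hcos
  exact hΩ.mem_radii hrI (e ▸ hx)

end IsRotSymmDomain

/-- This extends formulas known on `Ω` to the radial extension on a full neighbourhood in space, as
needed for differentiability there. -/
theorem eventually_normalize_mem {Ω : Set S2} (hΩ : IsOpen Ω) {x₀ : S2} (hx₀ : x₀ ∈ Ω) :
    ∀ᶠ x in 𝓝 (x₀ : E3), ∀ y : S2, x = ‖x‖ • (y : E3) → y ∈ Ω := by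
  obtain ⟨V, hV, rfl⟩ := isOpen_induced_iff.1 hΩ
  have hc : ContinuousAt (fun x : E3 => ‖x‖⁻¹ • x) x₀ :=
    (continuousAt_id.norm.inv₀ (norm_ne_zero_iff.2 (S2_ne_zero x₀))).smul continuousAt_id
  have hmem : ‖(x₀ : E3)‖⁻¹ • (x₀ : E3) ∈ V := by
    rw [norm_S2, inv_one, one_smul]
    exact hx₀
  filter_upwards [hc.eventually (hV.mem_nhds hmem), isOpen_ne.mem_nhds (S2_ne_zero x₀)]
    with x hx hx0 y hy
  have : ‖x‖⁻¹ • x = (y : E3) := by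
    conv_lhs => rw [hy]
    rw [norm_smul, norm_norm, norm_S2, mul_one, smul_smul,
      inv_mul_cancel₀ (norm_ne_zero_iff.2 hx0), one_smul]
  rw [this] at hx
  exact hx

/-- A function `w(θ) / sin r` with `w` of class `C²` is of class `C²` away from the poles. -/
theorem contDiffAt_of_eq_div_sin {Ω : Set S2} (hΩ : IsOpen Ω) {u : S2 → ℝ} {w : ℝ → ℝ}
    (hw : ContDiff ℝ 2 w)
    (hu : ∀ r ∈ Set.Ioo 0 π, ∀ θ, polarPoint r θ ∈ Ω → u (polarPoint r θ) = w θ / sin r)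
    {r₀ θ₀ : ℝ} (hr₀ : r₀ ∈ Set.Ioo 0 π) (h₀ : polarPoint r₀ θ₀ ∈ Ω) :
    ContDiffAt ℝ 2 (radialExtension u) (polarPoint r₀ θ₀ : E3) := by
  let ζ : E3 → ℂ := fun x => ((x 0 : ℝ) : ℂ) + (x 1 : ℝ) * Complex.I
  -- Rotating the azimuth `θ₀` to the positive real axis keeps the branch cut of the logarithm away
  -- from the base point.
  let η : E3 → ℂ := fun x => ζ x * Complex.exp (-(θ₀ * Complex.I))
  have hζ : ContDiff ℝ 2 ζ := by
    have h0 : ContDiff ℝ 2 fun x : E3 => x 0 := contDiff_piLp_apply 2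
    have h1 : ContDiff ℝ 2 fun x : E3 => x 1 := contDiff_piLp_apply 2
    exact (Complex.ofRealCLM.contDiff.comp h0).add
      ((Complex.ofRealCLM.contDiff.comp h1).mul contDiff_const)
  have hη : ContDiff ℝ 2 η := hζ.mul contDiff_const
  have hs := sin_pos_of_mem hr₀
  have hη₀ : η (polarPoint r₀ θ₀ : E3) = (sin r₀ : ℝ) := by
    have e : ζ (polarPoint r₀ θ₀ : E3) = (sin r₀ : ℝ) * Complex.exp (θ₀ * Complex.I) := by
      simp [ζ, polarPoint, Complex.exp_mul_I]
      ring
    simp only [η]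
    rw [e, mul_assoc, ← Complex.exp_add]
    simp
  have hslit : η (polarPoint r₀ θ₀ : E3) ∈ Complex.slitPlane := by
    rw [hη₀]
    exact Complex.ofReal_mem_slitPlane.2 hs
  have harg : ContDiffAt ℝ 2 (fun x => (Complex.log (η x)).im) (polarPoint r₀ θ₀ : E3) := by
    have h1 : ContDiffAt ℝ 2 Complex.log (η (polarPoint r₀ θ₀ : E3)) :=
      (Complex.contDiffAt_log hslit).restrict_scalars ℝ
    exact Complex.imCLM.contDiff.contDiffAt.comp _ (h1.comp _ hη.contDiffAt)
  have hne : η (polarPoint r₀ θ₀ : E3) ≠ 0 := Complex.slitPlane_ne_zero hslit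
  -- Near the base point this is the radial extension: the azimuth is `θ₀ + arg η`, and `sin r = ‖η
  -- x‖ / ‖x‖`.
  have hsmooth : ContDiffAt ℝ 2
      (fun x => w (θ₀ + (Complex.log (η x)).im) * (‖x‖ / ‖η x‖)) (polarPoint r₀ θ₀ : E3) :=
    (hw.contDiffAt.comp _ (contDiffAt_const.add harg)).mul
      ((contDiffAt_norm ℝ (S2_ne_zero _)).div (hη.contDiffAt.norm ℝ hne) (norm_ne_zero_iff.2 hne))
  refine hsmooth.congr_of_eventuallyEq ?_
  filter_upwards [eventually_normalize_mem hΩ h₀, isOpen_ne.mem_nhds (S2_ne_zero _),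
    hη.continuous.continuousAt.eventually (isOpen_ne.mem_nhds hne)] with x hx hx0 hηx
  have hρ : 0 < ‖η x‖ := norm_pos_iff.2 hηx
  have hpol : ζ x = ‖η x‖ * Complex.exp (((θ₀ + (η x).arg : ℝ) : ℂ) * Complex.I) := by
    have e1 : ζ x = η x * Complex.exp (θ₀ * Complex.I) := by
      simp only [η]
      rw [mul_assoc, ← Complex.exp_add]
      simp
    rw [e1, Complex.ofReal_add, add_mul, Complex.exp_add]
    conv_lhs => rw [← Complex.norm_mul_exp_arg_mul_I (η x)]
    ring
  have hx0' : x 0 = ‖η x‖ * cos (θ₀ + (η x).arg) := by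
    have := congrArg Complex.re hpol
    rw [Complex.re_ofReal_mul, Complex.exp_ofReal_mul_I_re] at this
    simpa [ζ] using this
  have hx1' : x 1 = ‖η x‖ * sin (θ₀ + (η x).arg) := by
    have := congrArg Complex.im hpol
    rw [Complex.im_ofReal_mul, Complex.exp_ofReal_mul_I_im] at this
    simpa [ζ] using this
  obtain ⟨r, hr, hρr, e⟩ := exists_polar_angle hρ hx0' hx1'
  have hxpos : 0 < ‖x‖ := norm_pos_iff.2 hx0
  have e1 : radialExtension u x = u (polarPoint r (θ₀ + (η x).arg)) := by
    conv_lhs => rw [e]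
    exact radialExtension_smul u _ hxpos
  rw [e1, hu r hr _ (hx _ e), Complex.log_im, hρr]
  have := sin_pos_of_mem hr
  field_simp

/-! ### Separation of variables -/

/-- A continuous function on a preconnected set with values in the discrete set `{0, m, -m}` is
constant. It handles functions whose zeros cannot be excluded in advance. -/
theorem eq_of_abs_eq_or_eq_zero {X : Type*} [TopologicalSpace X] {s : Set X}
    (hs : IsPreconnected s) {f : X → ℝ} (hf : ContinuousOn f s) {m : ℝ}
    (h : ∀ x ∈ s, f x ≠ 0 → |f x| = m) {x y : X} (hx : x ∈ s) (hy : y ∈ s) : f x = f y := by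
  have hfin : ({0, m, -m} : Set ℝ).Finite := Set.toFinite _
  refine hs.constant_of_mapsTo hfin.isDiscrete hf (fun z hz => ?_) hx hy
  by_cases h0 : f z = 0
  · simp [h0]
  · have := h z hz h0
    rcases abs_choice (f z) with e | e
    · right; left; linarith
    · right; right; rw [Set.mem_singleton_iff]; linarith

theorem hasDerivAt_mul_sin_rpow (K p : ℝ) {r : ℝ} (hr : 0 < sin r) :
    HasDerivAt (fun r => K * sin r ^ p) (K * p * sin r ^ (p - 1) * cos r) r :=
  (((hasDerivAt_sin r).rpow_const (p := p) (Or.inl hr.ne')).const_mul K).congr_deriv (by ring)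

theorem deriv_deriv_mul_sin_rpow (K p : ℝ) {r : ℝ} (hr : r ∈ Set.Ioo 0 π) :
    deriv (deriv fun r => K * sin r ^ p) r =
      K * p * sin r ^ p * ((p - 1) * cos r ^ 2 / sin r ^ 2 - 1) := by
  have hs := sin_pos_of_mem hr
  have e : deriv (fun r => K * sin r ^ p) =ᶠ[𝓝 r] fun r => K * p * sin r ^ (p - 1) * cos r := by
    filter_upwards [isOpen_Ioo.mem_nhds hr] with x hx
    exact (hasDerivAt_mul_sin_rpow K p (sin_pos_of_mem hx)).deriv
  rw [e.deriv_eq]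
  refine ((hasDerivAt_mul_sin_rpow (K * p) (p - 1) hs).mul (hasDerivAt_cos r)).deriv.trans ?_
  rw [rpow_sub_one hs.ne', rpow_sub_one hs.ne']
  field_simp
  ring

/-- Identities are derived only at radii with `h r ≠ 0`. Connectedness of `J` then shows that `h`
has no zeros there and equals a constant times a power of `sin r`. -/
theorem separation_of_variables {J : Set ℝ} (hJo : IsOpen J) (hJp : IsPreconnected J)
    (hJ : J ⊆ Set.Ioo 0 π) {ε q : ℝ} (hε : ε ≠ 0) (hq : q ≠ 1) {h w : ℝ → ℝ}
    (hh : ContinuousOn h J) (hw : Continuous w)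
    (pde : ∀ r ∈ J, ∀ θ, deriv (deriv h) r * w θ + cos r / sin r * (deriv h r * w θ) +
      h r * deriv (deriv w) θ / sin r ^ 2 = ε * (h r * w θ * |h r * w θ| ^ (q - 1)))
    {r₀ : ℝ} (hr₀ : r₀ ∈ J) (h₀ : h r₀ ≠ 0) {a b : ℝ} (hab : w a ≠ w b) :
    q = 3 ∧ ∃ K : ℝ, K ≠ 0 ∧ (∀ r ∈ J, h r = K / sin r) ∧
      ∀ θ, deriv (deriv w) θ = -w θ + ε * K ^ 2 * w θ ^ 3 := by
  have hq1 : q - 1 ≠ 0 := sub_ne_zero.2 hq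
  have hsin : ∀ r ∈ J, 0 < sin r := fun r hr => sin_pos_of_mem (hJ hr)
  obtain ⟨θ₁, hθ₁⟩ : ∃ θ, w θ ≠ 0 := by
    by_contra hcon
    push Not at hcon
    exact hab (by rw [hcon, hcon])
  let A : ℝ → ℝ := fun r => (deriv (deriv h) r + cos r / sin r * deriv h r) * sin r ^ 2 / h r
  let κ : ℝ → ℝ := fun r => |h r| ^ (q - 1) * sin r ^ 2
  have ode : ∀ r ∈ J, h r ≠ 0 → ∀ θ,
      deriv (deriv w) θ = -A r * w θ + ε * κ r * (w θ * |w θ| ^ (q - 1)) := by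
    intro r hr hhr θ
    have e := pde r hr θ
    rw [abs_mul, mul_rpow (abs_nonneg _) (abs_nonneg _)] at e
    have hs := hsin r hr
    simp only [A, κ]
    field_simp at e ⊢
    linear_combination e
  have hκ : ∀ r ∈ J, h r ≠ 0 → κ r = κ r₀ := by
    intro r hr hhr
    -- Subtracting the equations at `r` and `r₀` would give `|w|^(q-1)` one fixed value wherever `w
    -- ≠ 0`, and continuity would make `w` constant.
    by_contra hne
    have hpow : ∀ θ, w θ ≠ 0 → |w θ| ^ (q - 1) = (A r₀ - A r) / (ε * (κ r₀ - κ r)) := by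
      intro θ hθ
      have hne' : κ r₀ - κ r ≠ 0 := sub_ne_zero.2 (Ne.symm hne)
      rw [eq_div_iff (mul_ne_zero hε hne')]
      apply mul_left_cancel₀ hθ
      linear_combination ode r hr hhr θ - ode r₀ hr₀ h₀ θ
    refine hab (eq_of_abs_eq_or_eq_zero isPreconnected_univ hw.continuousOn (m := |w θ₁|)
      (fun θ _ hθ => ?_) trivial trivial)
    exact (rpow_left_inj (abs_nonneg _) (abs_nonneg _) hq1).1
      ((hpow θ hθ).trans (hpow θ₁ hθ₁).symm)
  have hA : ∀ r ∈ J, h r ≠ 0 → A r = A r₀ := by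
    intro r hr hhr
    have e := (ode r hr hhr θ₁).symm.trans (ode r₀ hr₀ h₀ θ₁)
    rw [hκ r hr hhr] at e
    apply mul_right_cancel₀ hθ₁
    linarith
  have hκpos : 0 < κ r₀ := by
    have := hsin r₀ hr₀
    have := abs_pos.2 h₀
    positivity
  -- The value of `|h r|` obtained by solving `κ r = κ r₀`.
  let H : ℝ → ℝ := fun r => (κ r₀ / sin r ^ 2) ^ (q - 1)⁻¹
  have hHpos : ∀ r ∈ J, 0 < H r := fun r hr => by
    have := hsin r hr
    simp only [H]
    positivity
  have hHeq : ∀ r ∈ J, h r ≠ 0 → |h r| = H r := by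
    intro r hr hhr
    have hs := hsin r hr
    have e : κ r₀ / sin r ^ 2 = |h r| ^ (q - 1) := by
      rw [← hκ r hr hhr]
      simp only [κ]
      field_simp
    simp only [H]
    rw [e, rpow_rpow_inv (abs_nonneg _) hq1]
  have hHcont : ContinuousOn H J := by
    refine ContinuousOn.rpow_const (ContinuousOn.div continuousOn_const (by fun_prop)
      fun r hr => pow_ne_zero 2 (hsin r hr).ne') fun r hr => Or.inl ?_
    have := hsin r hr
    positivity
  have hσ : ∀ r ∈ J, h r / H r = h r₀ / H r₀ := fun r hr =>
    eq_of_abs_eq_or_eq_zero (f := h / H) hJp (hh.div hHcont fun r hr => (hHpos r hr).ne') (m := 1)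
      (fun r hr hne => by
        have hhr : h r ≠ 0 := fun h0 => hne (by simp [h0])
        rw [Pi.div_apply, abs_div, hHeq r hr hhr, abs_of_pos (hHpos r hr),
          div_self (hHpos r hr).ne']) hr hr₀
  obtain ⟨p, hp⟩ : ∃ p, p = -(2 * (q - 1)⁻¹) := ⟨_, rfl⟩
  obtain ⟨K, hK⟩ : ∃ K, K = h r₀ / H r₀ * κ r₀ ^ (q - 1)⁻¹ := ⟨_, rfl⟩
  have hK0 : K ≠ 0 := by
    rw [hK]
    exact mul_ne_zero (div_ne_zero h₀ (hHpos r₀ hr₀).ne') (rpow_pos_of_pos hκpos _).ne'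
  have hform : ∀ r ∈ J, h r = K * sin r ^ p := by
    intro r hr
    have hs := hsin r hr
    have e1 : h r = h r₀ / H r₀ * H r := by
      rw [← hσ r hr, div_mul_cancel₀ _ (hHpos r hr).ne']
    have e2 : H r = κ r₀ ^ (q - 1)⁻¹ * sin r ^ p := by
      simp only [H]
      rw [div_rpow hκpos.le (by positivity), ← rpow_natCast, ← rpow_mul hs.le, hp,
        rpow_neg hs.le, div_eq_mul_inv]
      norm_num
    rw [e1, e2, hK]
    ring
  have hne : ∀ r ∈ J, h r ≠ 0 := fun r hr => by
    rw [hform r hr]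
    exact mul_ne_zero hK0 (rpow_pos_of_pos (hsin r hr) _).ne'
  have hAform : ∀ r ∈ J, A r = p ^ 2 * cos r ^ 2 - p * sin r ^ 2 := by
    intro r hr
    have hs := hsin r hr
    have hev : h =ᶠ[𝓝 r] fun r => K * sin r ^ p := by
      filter_upwards [hJo.mem_nhds hr] with x hx using hform x hx
    have hpos := rpow_pos_of_pos hs p
    simp only [A]
    rw [hev.deriv.deriv_eq, hev.deriv_eq, deriv_deriv_mul_sin_rpow K p (hJ hr),
      (hasDerivAt_mul_sin_rpow K p hs).deriv, hform r hr, rpow_sub_one hs.ne']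
    field_simp
    ring
  have hp0 : p ≠ 0 := by
    rw [hp]
    exact neg_ne_zero.2 (mul_ne_zero two_ne_zero (inv_ne_zero hq1))
  -- The derivative of `p² cos² r - p sin² r` is `-2 (p² + p) sin r cos r`. It vanishes on the open
  -- set `J`, whereas `cos` cannot vanish on an open set.
  have hp1 : p = -1 := by
    by_contra hp1
    have hpp : p ^ 2 + p ≠ 0 := by
      rw [show p ^ 2 + p = p * (p + 1) by ring]
      exact mul_ne_zero hp0 fun h => hp1 (by linarith)
    have hcos : ∀ r ∈ J, cos r = 0 := by
      intro r hr
      have hev : (fun r => p ^ 2 * cos r ^ 2 - p * sin r ^ 2) =ᶠ[𝓝 r] fun _ => A r₀ := by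
        filter_upwards [hJo.mem_nhds hr] with x hx
        rw [← hAform x hx, hA x hx (hne x hx)]
      have hd := ((((hasDerivAt_cos r).pow 2).const_mul (p ^ 2)).sub
        (((hasDerivAt_sin r).pow 2).const_mul p)).deriv
      have h0 := hev.deriv_eq
      rw [deriv_const] at h0
      have e := hd.symm.trans h0
      have e' : (p ^ 2 + p) * (cos r * sin r) = 0 := by
        norm_num at e
        linarith
      rcases mul_eq_zero.1 e' with e' | e'
      · exact (hpp e').elim
      · exact (mul_eq_zero.1 e').resolve_right (hsin r hr).ne'
    have hev : cos =ᶠ[𝓝 r₀] fun _ => 0 := by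
      filter_upwards [hJo.mem_nhds hr₀] with x hx using hcos x hx
    have := hev.deriv_eq
    rw [deriv_const, (hasDerivAt_cos r₀).deriv] at this
    linarith [hsin r₀ hr₀]
  have hq3 : q = 3 := by
    rw [hp1] at hp
    field_simp at hp
    linarith
  have hform' : ∀ r ∈ J, h r = K / sin r := fun r hr => by
    rw [hform r hr, hp1, rpow_neg_one, div_eq_mul_inv]
  refine ⟨hq3, K, hK0, hform', fun θ => ?_⟩
  have e := ode r₀ hr₀ h₀ θ
  have hs := hsin r₀ hr₀
  have hA1 : A r₀ = 1 := by
    rw [hAform r₀ hr₀, hp1]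
    linear_combination sin_sq_add_cos_sq r₀
  have hκK : κ r₀ = K ^ 2 := by
    simp only [κ]
    rw [hq3, show (3 : ℝ) - 1 = (2 : ℕ) by norm_num, rpow_natCast, sq_abs, hform' r₀ hr₀]
    field_simp
  rw [hA1, hκK, hq3, show (3 : ℝ) - 1 = (2 : ℕ) by norm_num, rpow_natCast, sq_abs] at e
  rw [e]
  ring

/-! ### From the equation on the sphere to the ODE and back -/

theorem contDiff_polarPoint_left (θ : ℝ) : ContDiff ℝ 2 fun r => (polarPoint r θ : E3) := by
  refine contDiff_piLp' 2 fun i => ?_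
  fin_cases i
  · exact contDiff_sin.mul contDiff_const
  · exact contDiff_sin.mul contDiff_const
  · exact contDiff_cos

theorem contDiff_polarPoint_right (r : ℝ) : ContDiff ℝ 2 fun θ => (polarPoint r θ : E3) := by
  refine contDiff_piLp' 2 fun i => ?_
  fin_cases i
  · exact contDiff_const.mul contDiff_cos
  · exact contDiff_const.mul contDiff_sin
  · exact contDiff_const

/-- A non-radial pseudo-radial solution exists only for `q = 3`, and then it has the form
`W(θ) / sin r`. -/
theorem nonradial_form {Ω : Set S2} (hΩ : IsRotSymmDomain Ω) {ε q : ℝ} (hε : ε ≠ 0)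
    (hq : q ≠ 1) {u : S2 → ℝ} (hu : IsSphereSolution Ω (fun t => ε * (t * |t| ^ (q - 1))) u)
    (hps : IsPseudoRadial Ω u) (hrad : ¬ IsRadial Ω u) :
    q = 3 ∧ ∃ W P : ℝ → ℝ, Function.Periodic W (2 * π) ∧ (∀ θ, HasDerivAt W (P θ) θ) ∧
      (∀ θ, HasDerivAt P (-W θ + ε * W θ ^ 3) θ) ∧ (∃ a b, W a ≠ W b) ∧
      ∀ r ∈ Set.Ioo 0 π, ∀ θ, polarPoint r θ ∈ Ω → u (polarPoint r θ) = W θ / sin r := by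
  obtain ⟨h, w, hper, huw⟩ := hps
  have huJ : ∀ r ∈ radii Ω, ∀ θ, u (polarPoint r θ) = h r * w θ := fun r hr θ =>
    huw r hr.1 θ (hΩ.mem_of_mem_radii hr θ)
  have haway : ∀ r ∈ radii Ω, ∀ θ, polarPoint r θ ∈ awayFromPoles Ω := fun r hr θ =>
    ⟨r, hr.1, θ, rfl, hΩ.mem_of_mem_radii hr θ⟩
  obtain ⟨r₀, hr₀, h₀⟩ : ∃ r ∈ radii Ω, h r ≠ 0 := by
    by_contra hcon
    push Not at hcon
    refine hrad ⟨fun _ => 0, fun r hr θ hm => ?_⟩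
    rw [huw r hr θ hm, hcon r (hΩ.mem_radii hr hm), zero_mul]
  obtain ⟨a, b, hab⟩ : ∃ a b, w a ≠ w b := by
    by_contra hcon
    push Not at hcon
    refine hrad ⟨fun r => h r * w 0, fun r hr θ hm => ?_⟩
    rw [huw r hr θ hm, hcon θ 0]
  obtain ⟨θ₁, hθ₁⟩ : ∃ θ, w θ ≠ 0 := by
    by_contra hcon
    push Not at hcon
    exact hab (by rw [hcon, hcon])
  -- No regularity of the factors is given. `w` inherits it from `u` on a parallel with `h r₀ ≠ 0`,
  -- and `h` from `u` on a meridian with `w θ₁ ≠ 0`.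
  have hwC : ContDiff ℝ 2 w := by
    have e : w = fun θ => (h r₀)⁻¹ * radialExtension u (polarPoint r₀ θ : E3) := by
      funext θ
      rw [radialExtension_coe, huJ r₀ hr₀, inv_mul_cancel_left₀ h₀]
    rw [e]
    refine contDiff_const.mul (contDiff_iff_contDiffAt.2 fun θ => ?_)
    exact (hu _ (haway r₀ hr₀ θ)).1.comp θ (contDiff_polarPoint_right r₀).contDiffAt
  have hhC : ContinuousOn h (radii Ω) := by
    intro r hr
    refine ContinuousAt.continuousWithinAt ?_
    have hc : ContinuousAt (fun r => radialExtension u (polarPoint r θ₁ : E3) * (w θ₁)⁻¹) r :=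
      (ContinuousAt.comp (f := fun r => (polarPoint r θ₁ : E3))
        (hu _ (haway r hr θ₁)).1.continuousAt
        (contDiff_polarPoint_left θ₁).continuous.continuousAt).mul continuousAt_const
    refine hc.congr ?_
    filter_upwards [hΩ.isOpen_radii.mem_nhds hr] with x hx
    rw [radialExtension_coe, huJ x hx, mul_inv_cancel_right₀ hθ₁]
  have pde : ∀ r ∈ radii Ω, ∀ θ,
      deriv (deriv h) r * w θ + cos r / sin r * (deriv h r * w θ) +
        h r * deriv (deriv w) θ / sin r ^ 2 = ε * (h r * w θ * |h r * w θ| ^ (q - 1)) := by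
    intro r hr θ
    obtain ⟨hC, hL⟩ := hu _ (haway r hr θ)
    rw [sphereLaplacian_polarPoint (sin_pos_of_mem hr.1).ne' hC] at hL
    have e1 : (fun r => u (polarPoint r θ)) =ᶠ[𝓝 r] fun r => h r * w θ := by
      filter_upwards [hΩ.isOpen_radii.mem_nhds hr] with x hx using huJ x hx θ
    have e2 : (fun θ => u (polarPoint r θ)) = fun θ => h r * w θ := funext (huJ r hr)
    rw [e1.deriv.deriv_eq, e1.deriv_eq, e2] at hL
    simp only [deriv_mul_const_field', deriv_const_mul_field', deriv_mul_const_field,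
      deriv_const_mul_field, huJ r hr θ] at hL
    exact hL
  obtain ⟨hq3, K, hK, hhK, hode⟩ := separation_of_variables hΩ.isOpen_radii
    hΩ.isPreconnected_radii (fun r hr => hr.1) hε hq hhC hwC.continuous pde hr₀ h₀ hab
  -- Absorbing `K` into the angular factor turns the coefficient `ε * K ^ 2` of the cubic into `ε`.
  refine ⟨hq3, fun θ => K * w θ, fun θ => K * deriv w θ, fun θ => ?_, fun θ => ?_, fun θ => ?_,
    ⟨a, b, fun h => hab (mul_left_cancel₀ hK h)⟩, fun r hr θ hm => ?_⟩
  · simp only [hper θ]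
  · exact (hwC.hasDerivAt_iteratedDeriv_two θ).1.const_mul K
  · refine ((hwC.hasDerivAt_iteratedDeriv_two θ).2.const_mul K).congr_deriv ?_
    rw [iteratedDeriv_succ, iteratedDeriv_one, hode]
    ring
  · rw [huw r hr θ hm, hhK r (hΩ.mem_radii hr hm)]
    ring

/-- Conversely, `W(θ) / sin r` is a solution if `W'' + W = -W³`. -/
theorem isSphereSolution_of_solvesODE {Ω : Set S2} (hΩ : IsRotSymmDomain Ω) {u : S2 → ℝ}
    {W : ℝ → ℝ} (hW : SolvesODE W)
    (hu : ∀ r ∈ Set.Ioo 0 π, ∀ θ, polarPoint r θ ∈ Ω → u (polarPoint r θ) = W θ / sin r) :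
    IsSphereSolution Ω (fun t => -t ^ 3) u := by
  rintro _ ⟨r, hr, θ, rfl, hm⟩
  have hC := contDiffAt_of_eq_div_sin hΩ.isOpen hW.1 hu hr hm
  refine ⟨hC, ?_⟩
  have hs := sin_pos_of_mem hr
  have hrJ := hΩ.mem_radii hr hm
  rw [sphereLaplacian_polarPoint hs.ne' hC]
  have e1 : (fun r => u (polarPoint r θ)) =ᶠ[𝓝 r] fun r => W θ * sin r ^ (-1 : ℝ) := by
    filter_upwards [hΩ.isOpen_radii.mem_nhds hrJ] with x hx
    rw [hu x hx.1 θ (hΩ.mem_of_mem_radii hx θ), rpow_neg_one, div_eq_mul_inv]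
  have e2 : (fun θ => u (polarPoint r θ)) = fun θ => W θ / sin r :=
    funext fun θ => hu r hr θ (hΩ.mem_of_mem_radii hrJ θ)
  have e3 : deriv (fun θ => W θ / sin r) = fun θ => deriv W θ / sin r :=
    funext fun θ => deriv_div_const _
  have hode := hW.2 θ
  rw [iteratedDeriv_succ, iteratedDeriv_one] at hode
  rw [e1.deriv.deriv_eq, e1.deriv_eq, e2, e3, deriv_deriv_mul_sin_rpow _ _ hr,
    (hasDerivAt_mul_sin_rpow _ _ hs).deriv, hu r hr θ hm, rpow_sub_one hs.ne', rpow_neg_one,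
    deriv_div_const, show deriv (deriv W) θ = -W θ - W θ ^ 3 by linarith]
  field_simp
  linear_combination W θ * sin_sq_add_cos_sq r

/-! ### The classification -/

theorem solvesODE_orbit (s : ℝ) : SolvesODE (orbit s) := by
  simpa using solvesODE_orbit_add s 0

theorem hasLeastPeriod_orbit_slopeOf {k : ℕ} (hk : 2 ≤ k) (c : ℝ) :
    HasLeastPeriod (fun t => orbit (slopeOf k) (t + c)) (2 * π / k) := by
  rw [← (slopeOf_spec hk).2]
  exact hasLeastPeriod_orbit_add (slopeOf_spec hk).1 c

theorem periodic_orbit_slopeOf {k : ℕ} (hk : 2 ≤ k) (c : ℝ) :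
    Function.Periodic (fun t => orbit (slopeOf k) (t + c)) (2 * π) := by
  have h := (hasLeastPeriod_orbit_slopeOf hk c).1.2.nat_mul k
  have hk0 : (k : ℝ) ≠ 0 := by positivity
  rwa [mul_div_cancel₀ _ hk0] at h

/-- If `u` were radial, its angular factor would be constant, and a constant has no least positive
period. -/
theorem mem_nonradial_of_eq {Ω : Set S2} (hΩ : IsRotSymmDomain Ω) {u : S2 → ℝ} {k : ℕ}
    (hk : 2 ≤ k) {c : ℝ} (hu : ∀ r ∈ Set.Ioo 0 π, ∀ θ : ℝ, polarPoint r θ ∈ Ω →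
      u (polarPoint r θ) = orbit (slopeOf k) (θ + c) / sin r) :
    u ∈ nonradialPseudoRadialSolutions Ω := by
  refine ⟨isSphereSolution_of_solvesODE hΩ (solvesODE_orbit_add (slopeOf k) c) hu,
    ⟨fun r => (sin r)⁻¹, _, periodic_orbit_slopeOf hk c, fun r hr θ hm => ?_⟩, ?_⟩
  · rw [hu r hr θ hm, div_eq_inv_mul]
  · rintro ⟨h, hh⟩
    obtain ⟨r, hr⟩ := hΩ.nonempty_radii
    have hs := sin_pos_of_mem hr.1
    have hconst : (fun t => orbit (slopeOf k) (t + c)) = fun _ => h r * sin r := by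
      funext θ
      have hm := hΩ.mem_of_mem_radii hr θ
      rw [← hh r hr.1 θ hm, hu r hr.1 θ hm, div_mul_cancel₀ _ hs.ne']
    have := hasLeastPeriod_orbit_slopeOf hk c
    rw [hconst] at this
    exact not_hasLeastPeriod_const _ _ this

theorem exists_eq_of_mem_nonradial {Ω : Set S2} (hΩ : IsRotSymmDomain Ω) {u : S2 → ℝ}
    (hu : u ∈ nonradialPseudoRadialSolutions Ω) :
    ∃ k : ℕ, 2 ≤ k ∧ ∃ c : ℝ, ∀ r ∈ Set.Ioo 0 π, ∀ θ : ℝ, polarPoint r θ ∈ Ω →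
      u (polarPoint r θ) = orbit (slopeOf k) (θ + c) / sin r := by
  obtain ⟨hsol, hps, hrad⟩ := hu
  have hf : (fun t : ℝ => -t ^ 3) = fun t => (-1) * (t * |t| ^ ((3 : ℝ) - 1)) := by
    funext t
    rw [show (3 : ℝ) - 1 = (2 : ℕ) by norm_num, rpow_natCast, sq_abs]
    ring
  rw [hf] at hsol
  obtain ⟨-, W, P, hper, h1, h2, ⟨a, b, hab⟩, hW⟩ :=
    nonradial_form hΩ (by norm_num) (by norm_num) hsol hps hrad
  have hode : SolvesODE W := solvesODE_iff.2 ⟨P, h1, fun t => (h2 t).congr_deriv (by ring)⟩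
  have hne : ∃ t, W t ≠ 0 := by
    by_contra hcon
    push Not at hcon
    exact hab (by rw [hcon, hcon])
  obtain ⟨k, hk, c, rfl⟩ := hode.exists_of_periodic hper hne
  exact ⟨k, hk, c, hW⟩

/-- For a `2π`-periodic `w` the function `w(θ) / sin r` is well defined on the sphere. -/
theorem exists_sphere_function {w : ℝ → ℝ} (hw : Function.Periodic w (2 * π)) :
    ∃ u : S2 → ℝ, ∀ r ∈ Set.Ioo 0 π, ∀ θ : ℝ, u (polarPoint r θ) = w θ / sin r := by
  refine ⟨fun x => w (Complex.arg ⟨x.1 0, x.1 1⟩) / ‖(⟨x.1 0, x.1 1⟩ : ℂ)‖, fun r hr θ => ?_⟩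
  have hs := sin_pos_of_mem hr
  have e : (⟨(polarPoint r θ).1 0, (polarPoint r θ).1 1⟩ : ℂ) =
      (sin r : ℝ) * (Complex.cos θ + Complex.sin θ * Complex.I) := by
    apply Complex.ext
    · rw [Complex.re_ofReal_mul, Complex.cos_add_sin_I, Complex.exp_ofReal_mul_I_re]
      rfl
    · rw [Complex.im_ofReal_mul, Complex.cos_add_sin_I, Complex.exp_ofReal_mul_I_im]
      rfl
  simp only [e]
  -- The principal argument differs from `θ` by a multiple of `2π`, which the periodicity of `w`
  -- absorbs.
  rw [Complex.arg_mul_cos_add_sin_mul_I_eq_toIocMod hs, norm_mul, Complex.cos_add_sin_I,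
    Complex.norm_exp_ofReal_mul_I, Complex.norm_real, Real.norm_eq_abs, abs_of_pos hs, mul_one,
    toIocMod, hw.sub_zsmul_eq]

/-- Different `k` give different least periods, hence different functions. Restricting to the points
of `Ω` off the poles matters: arbitrary values elsewhere could otherwise produce infinitely many
functions trivially. -/
theorem infinite_nonradial {Ω : Set S2} (hΩ : IsRotSymmDomain Ω) :
    ((fun u : S2 → ℝ => (awayFromPoles Ω).domRestrict u) ''
      nonradialPseudoRadialSolutions Ω).Infinite := by
  have hex : ∀ k : ℕ, ∃ u : S2 → ℝ, ∀ r ∈ Set.Ioo 0 π, ∀ θ : ℝ,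
      u (polarPoint r θ) = orbit (slopeOf (k + 2)) (θ + 0) / sin r := fun k =>
    exists_sphere_function (periodic_orbit_slopeOf (by omega) 0)
  choose u hu using hex
  refine Set.infinite_of_injective_forall_mem
    (f := fun k : ℕ => (awayFromPoles Ω).domRestrict (u k)) (fun i j hij => ?_) fun k =>
      ⟨u k, mem_nonradial_of_eq hΩ (by omega) fun r hr θ _ => hu k r hr θ, rfl⟩
  obtain ⟨r, hr⟩ := hΩ.nonempty_radii
  have hs := sin_pos_of_mem hr.1
  have e : (fun t => orbit (slopeOf (i + 2)) (t + 0)) =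
      fun t => orbit (slopeOf (j + 2)) (t + 0) := by
    funext θ
    have h1 : u i (polarPoint r θ) = u j (polarPoint r θ) :=
      congrFun hij ⟨polarPoint r θ, r, hr.1, θ, rfl, hΩ.mem_of_mem_radii hr θ⟩
    rw [hu i r hr.1, hu j r hr.1] at h1
    exact (div_left_inj' hs.ne').1 h1
  have hi := hasLeastPeriod_orbit_slopeOf (k := i + 2) (by omega) 0
  have hj := hasLeastPeriod_orbit_slopeOf (k := j + 2) (by omega) 0
  rw [e] at hi
  have hT := hi.unique hj
  have h2 : ((i + 2 : ℕ) : ℝ) = (j + 2 : ℕ) := by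
    rw [div_eq_div_iff (by positivity) (by positivity)] at hT
    exact (mul_left_cancel₀ two_pi_pos.ne' hT).symm
  have h3 : i + 2 = j + 2 := by exact_mod_cast h2
  omega

theorem theorem4p5 :
    (∀ (Ω : Set S2), IsRotSymmDomain Ω →
      ∀ (ε q : ℝ), (ε = 1 ∨ ε = -1) → 0 < q → q ≠ 1 → (ε = 1 ∨ q ≠ 3) →
        ∀ u : S2 → ℝ, IsSphereSolution Ω (fun t => ε * (t * |t| ^ (q - 1))) u →
          IsPseudoRadial Ω u → IsRadial Ω u) ∧
    (∃ w : ℕ → ℝ → ℝ,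
      (∀ k : ℕ, 2 ≤ k →
        SolvesODE (w k) ∧ HasLeastPeriod (w k) (2 * Real.pi / k) ∧ w k 0 = 0 ∧
        (∀ v : ℝ → ℝ, SolvesODE v → HasLeastPeriod v (2 * Real.pi / k) → v 0 = 0 →
          v = w k ∨ v = -w k) ∧
        (∀ v : ℝ → ℝ, SolvesODE v → HasLeastPeriod v (2 * Real.pi / k) →
          ∃ c : ℝ, ∀ θ : ℝ, v θ = w k (θ + c))) ∧
      (∀ (Ω : Set S2), IsRotSymmDomain Ω →
        ((fun u : S2 → ℝ => (awayFromPoles Ω).domRestrict u) ''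
          nonradialPseudoRadialSolutions Ω).Infinite ∧
        ∀ u : S2 → ℝ, u ∈ nonradialPseudoRadialSolutions Ω ↔
          ∃ k : ℕ, 2 ≤ k ∧ ∃ c : ℝ, ∀ r ∈ Set.Ioo 0 Real.pi, ∀ θ : ℝ,
            polarPoint r θ ∈ Ω → u (polarPoint r θ) = w k (θ + c) / Real.sin r)) := by
  refine ⟨fun Ω hΩ ε q hε _ hq1 hεq u hsol hps => ?_, fun k => orbit (slopeOf k),
    fun k hk => ⟨solvesODE_orbit _, ?_, orbit_zero _, fun v hv hT hv0 => ?_, fun v hv hT => ?_⟩,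
    fun Ω hΩ => ⟨infinite_nonradial hΩ, fun u => ⟨exists_eq_of_mem_nonradial hΩ, ?_⟩⟩⟩
  · by_contra hrad
    have hε0 : ε ≠ 0 := by rcases hε with rfl | rfl <;> norm_num
    obtain ⟨hq3, W, P, hper, h1, h2, ⟨a, b, hab⟩, -⟩ :=
      nonradial_form hΩ hε0 hq1 hsol hps hrad
    rcases hεq with rfl | hq
    · exact hab (defocusing_eq h1 (fun t => (h2 t).congr_deriv (by ring)) hper a b)
    · exact hq hq3
  · simpa using hasLeastPeriod_orbit_slopeOf hk 0
  · obtain ⟨c, rfl⟩ := hv.exists_eq_orbit_slopeOf hk hT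
    exact orbit_add_of_eq_zero (by simpa using hv0)
  · obtain ⟨c, rfl⟩ := hv.exists_eq_orbit_slopeOf hk hT
    exact ⟨c, fun _ => rfl⟩
  · rintro ⟨k, hk, c, hu⟩
    exact mem_nonradial_of_eq hΩ hk hu
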